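/- For every $n \ge 1$ let $\rho_n : SU(2) \to U(E_n)$ be an irreducible unitary representation of the Lie group $SU(2)$ (differentiable at the identity, equivalently continuous) on a complex Hilbert space $E_n$ of dimension $n$. Let $\sigma_x, \sigma_y, \sigma_z$ be the Pauli matrices, and let $$J_k = i\,\frac{d}{dt}\Big|_{t=0}\, \rho_n\!\left(e^{-\frac{i}{2} t \sigma_k}\right), \qquad k \in \{x,y,z\},$$ be the corresponding self-adjoint generators, which satisfy $[J_x,J_y] = iJ_z$, $[J_y,J_z] = iJ_x$, $[J_z,J_x] = iJ_y$. Let $$C_n = \left[\mathbb{1}_{(0,\infty)}(J_x),\ \mathbb{1}_{(0,\infty)}(J_z)\right],$$ where $\mathbb{1}_{(0,\infty)}$ is the indicator function of $(0,\infty) \subset \mathbb{R}$, applied by the functional calculus of self-adjoint operators (so that $\mathbb{1}_{(0,\infty)}(J_k)$ is the orthogonal projection onto the span of all eigenvectors of $J_k$ with positive eigenvalue), and $[A,B]=AB-BA$. Then $$\lim_{n\to\infty} \Vert C_n \Vert_{\mathrm{op}} = \frac12 .$$ -/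

import Mathlib

namespace SpinCommutator

/-- The Pauli matrices `σ_x, σ_y, σ_z`, indexed by `0, 1, 2`. -/
def pauli : Fin 3 → Matrix (Fin 2) (Fin 2) ℂ :=
  ![!![0, 1; 1, 0], !![0, -Complex.I; Complex.I, 0], !![1, 0; 0, -1]]

/-- The element `-(i/2) (a₀ σ_x + a₁ σ_y + a₂ σ_z)` of the Lie algebra `su(2)`. -/
noncomputable def su2 (a : Fin 3 → ℝ) : Matrix (Fin 2) (Fin 2) ℂ :=
  (-(Complex.I / 2)) • ∑ k, (a k : ℂ) • pauli k

lemma su2_eq (a : Fin 3 → ℝ) :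
    su2 a = !![-(Complex.I / 2) * a 2, -(Complex.I / 2) * (a 0 - Complex.I * a 1);
      -(Complex.I / 2) * (a 0 + Complex.I * a 1), (Complex.I / 2) * a 2] := by
  ext i j
  fin_cases i <;> fin_cases j <;> simp [su2, pauli, Fin.sum_univ_three] <;> ring

lemma conjTranspose_su2 (a : Fin 3 → ℝ) : (su2 a).conjTranspose = -su2 a := by
  rw [su2_eq]
  ext i j
  fin_cases i <;> fin_cases j <;>
    simp [Matrix.conjTranspose_apply] <;> ring

lemma exp_mul_exp_neg_su2 (a : Fin 3 → ℝ) :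
    NormedSpace.exp (su2 a) * NormedSpace.exp (-su2 a) = 1 := by
  rw [← Matrix.exp_add_of_commute _ _ (Commute.refl (su2 a)).neg_right, add_neg_cancel,
    NormedSpace.exp_zero]

lemma exp_su2_mem (a : Fin 3 → ℝ) :
    NormedSpace.exp (su2 a) ∈ Matrix.specialUnitaryGroup (Fin 2) ℂ := by
  rw [Matrix.mem_specialUnitaryGroup_iff, Matrix.mem_unitaryGroup_iff]
  constructor
  · rw [Matrix.star_eq_conjTranspose, ← Matrix.exp_conjTranspose, conjTranspose_su2,
      exp_mul_exp_neg_su2]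
  · set S : Matrix (Fin 2) (Fin 2) ℂ := !![0, 1; -1, 0] with hS
    have hdet : S.det = 1 := by simp [hS, Matrix.det_fin_two]
    have hSu : IsUnit S := by
      rw [Matrix.isUnit_iff_isUnit_det, hdet]
      exact isUnit_one
    have hSinv : S⁻¹ = !![0, -1; 1, 0] := by
      rw [Matrix.inv_def, hdet, hS, Matrix.adjugate_fin_two]
      simp
    have h1 : -su2 a = S * (su2 a).transpose * S⁻¹ := by
      rw [hSinv, su2_eq, hS]
      ext i j
      fin_cases i <;> fin_cases j <;> simp [Matrix.mul_apply, Matrix.vecMul, dotProduct, Fin.sum_univ_two]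
    have h2 : NormedSpace.exp (-su2 a) = (NormedSpace.exp (su2 a)).adjugate := by
      rw [h1, Matrix.exp_conj _ _ hSu, Matrix.exp_transpose, hSinv, hS, Matrix.adjugate_fin_two]
      ext i j
      fin_cases i <;> fin_cases j <;> simp [Matrix.mul_apply, Matrix.vecMul, dotProduct, Fin.sum_univ_two]
    have h3 := exp_mul_exp_neg_su2 a
    rw [h2, Matrix.mul_adjugate] at h3
    simpa using congrFun (congrFun h3 0) 0

/-- The group `SU(2)`. -/
abbrev SU2 : Type := Matrix.specialUnitaryGroup (Fin 2) ℂ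

/-- The exponential map `a ↦ exp (-(i/2) (a₀ σ_x + a₁ σ_y + a₂ σ_z))` of `SU(2)`. -/
noncomputable def expSU2 (a : Fin 3 → ℝ) : SU2 :=
  ⟨NormedSpace.exp (su2 a), exp_su2_mem a⟩

section Rep

variable {E : Type*} [NormedAddCommGroup E] [InnerProductSpace ℂ E] [CompleteSpace E]

/-- The linear representation underlying a unitary representation. -/
noncomputable def toRepresentation (ρ : SU2 →* unitary (E →L[ℂ] E)) : Representation ℂ SU2 E :=
  (ContinuousLinearMap.toLinearMapRingHom (R₁ := ℂ) (M₁ := E)).toMonoidHom.comp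
    ((unitary (E →L[ℂ] E)).subtype.comp ρ)

/-- A unitary representation read in exponential coordinates around the identity. -/
noncomputable def inExpCoordinates (ρ : SU2 →* unitary (E →L[ℂ] E)) (a : Fin 3 → ℝ) : E →L[ℂ] E :=
  (ρ (expSU2 a) : E →L[ℂ] E)

/-- `ρ` is differentiable at the identity, so that it has infinitesimal generators. For a
homomorphism into a finite-dimensional unitary group this amounts to continuity, and to
smoothness. -/
def IsDifferentiable (ρ : SU2 →* unitary (E →L[ℂ] E)) : Prop :=
  DifferentiableAt ℝ (inExpCoordinates ρ) 0

/-- The generator `J_k = i ∂/∂a_k ρ (exp (-(i/2) a · σ))` at `a = 0`; the generators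
`J_x, J_y, J_z` are indexed by `0, 1, 2`. -/
noncomputable def J (ρ : SU2 →* unitary (E →L[ℂ] E)) (k : Fin 3) : E →L[ℂ] E :=
  Complex.I • fderiv ℝ (inExpCoordinates ρ) 0 (Pi.single k 1)

/-- The spectral projection `1_{(0,∞)}(A)`, by the functional calculus of self-adjoint
operators. -/
noncomputable def positiveProjection (A : E →L[ℂ] E) : E →L[ℂ] E :=
  cfc ((Set.Ioi (0 : ℝ)).indicator fun _ => (1 : ℝ)) A

/-- The commutator `[1_{(0,∞)}(J_x), 1_{(0,∞)}(J_z)]`. -/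
noncomputable def C (ρ : SU2 →* unitary (E →L[ℂ] E)) : E →L[ℂ] E :=
  ⁅positiveProjection (J ρ 0), positiveProjection (J ρ 2)⁆

end Rep

end SpinCommutator

namespace SpinCommutator

/-! The upper bound holds for every `n`: `2P - 1` and `2Q - 1` have norm at most `1`, and `[P, Q]`
is a quarter of their commutator (`norm_commutator_le_half`).

The lower bound comes from a Hilbert matrix hidden in the commutator. Let `e` and `f` be the weight
bases of `J_z` and `J_x`, and `M k l = ⟨e k, f l⟩`. Since `J_z` is tridiagonal in `f`, its
commutator with the positive projection of `J_x` has rank two, supported on the two vectors of `f`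
next to the cut. Taken in `e`, where `J_z` is diagonal, this gives `(k - k')` times the matrix
entries of the projection (`inner_positiveProjection`). For `k` odd and `k'` even a parity
phenomenon in the middle columns of `M` reduces the rank to one, so the entry is `g k * h k' / (k -
k')` (`IsOverlap.exists_factorization`). The middle columns are explicit products of central
binomial coefficients, and Wallis' product bounds `‖g k‖ * ‖h k'‖` below by nearly `1 / π` when `k`
and `k'` are near `n / 2`.

Between positive and nonpositive weights the commutator has these same entries up to sign
(`inner_commutator`). After removal of phases, a fixed-size block near the middle therefore
dominates `1 / (π (2 (s + t) + 5))` up to a factor tending to `1`. Testing on `1 / √(s + 1)` shows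
that the norms of large sections of `1 / (2 (s + t) + 5)` get at least arbitrarily close to `π / 2`
(`exists_hilbert_lower_bound`), which yields `1 / 2`. The size of the block is fixed before `n`
tends to infinity. -/

/-! ### Exponential coordinates and the adjoint action of SU(2). -/

lemma su2_add (a b : Fin 3 → ℝ) : su2 (a + b) = su2 a + su2 b := by
  simp only [su2_eq]
  ext i j
  fin_cases i <;> fin_cases j <;> simp <;> ring

lemma su2_smul (t : ℝ) (a : Fin 3 → ℝ) : su2 (t • a) = t • su2 a := by
  simp only [su2_eq]
  ext i j
  fin_cases i <;> fin_cases j <;> simp <;> ring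

lemma expSU2_add_smul (s t : ℝ) (a : Fin 3 → ℝ) :
    expSU2 ((s + t) • a) = expSU2 (s • a) * expSU2 (t • a) := by
  apply Subtype.ext
  change NormedSpace.exp _ = NormedSpace.exp _ * NormedSpace.exp _
  rw [add_smul, su2_add, Matrix.exp_add_of_commute]
  rw [su2_smul, su2_smul]
  exact ((Commute.refl (su2 a)).smul_left s).smul_right t

lemma expSU2_zero : expSU2 0 = 1 := by
  apply Subtype.ext
  change NormedSpace.exp _ = 1
  have : su2 0 = 0 := by
    have := su2_smul 0 0
    simpa using this
  rw [this, NormedSpace.exp_zero]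

lemma expSU2_neg (a : Fin 3 → ℝ) : expSU2 (-a) = (expSU2 a)⁻¹ := by
  rw [eq_inv_iff_mul_eq_one]
  have := expSU2_add_smul (-1) 1 a
  simpa [expSU2_zero] using this.symm

/-- The coordinates of a traceless anti-Hermitian matrix with respect to `-(i/2) σ`. -/
noncomputable def su2Coord : Matrix (Fin 2) (Fin 2) ℂ →ₗ[ℝ] (Fin 3 → ℝ) where
  toFun M := ![-2 * (M 0 1).im, -2 * (M 0 1).re, -2 * (M 0 0).im]
  map_add' M N := by ext i; fin_cases i <;> simp <;> ring
  map_smul' t M := by ext i; fin_cases i <;> simp <;> ring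

lemma su2Coord_su2 (a : Fin 3 → ℝ) : su2Coord (su2 a) = a := by
  rw [su2_eq]
  ext i
  fin_cases i <;> simp [su2Coord]

lemma su2_su2Coord {M : Matrix (Fin 2) (Fin 2) ℂ} (h : M.conjTranspose = -M) (ht : M.trace = 0) :
    su2 (su2Coord M) = M := by
  have h00 := congrFun (congrFun h 0) 0
  have h01 := congrFun (congrFun h 1) 0
  rw [Matrix.trace_fin_two] at ht
  have h11 : M 1 1 = - M 0 0 := by linear_combination ht
  simp only [Matrix.conjTranspose_apply, Matrix.neg_apply] at h00 h01
  have h10 : M 1 0 = - star (M 0 1) := by rw [h01]; simp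
  have hre : (M 0 0).re = 0 := by
    have := congrArg Complex.re h00
    simp at this
    linarith
  rw [su2_eq]
  ext i j
  fin_cases i <;> fin_cases j <;> apply Complex.ext <;>
    simp [su2Coord, h11, h10, hre]

/-- Conjugation by a unitary preserves being anti-Hermitian and traceless, so passing to coordinates
loses nothing. -/
lemma conj_su2 (g : SU2) (a : Fin 3 → ℝ) :
    su2 (su2Coord ((g : Matrix (Fin 2) (Fin 2) ℂ) * su2 a * (g⁻¹ : SU2))) =
      (g : Matrix (Fin 2) (Fin 2) ℂ) * su2 a * (g⁻¹ : SU2) := by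
  have hg : ((g⁻¹ : SU2) : Matrix (Fin 2) (Fin 2) ℂ) = (g : Matrix (Fin 2) (Fin 2) ℂ).conjTranspose :=
    rfl
  apply su2_su2Coord
  · rw [hg]
    simp [Matrix.conjTranspose_mul, conjTranspose_su2, Matrix.mul_assoc]
  · rw [Matrix.trace_mul_cycle, ← Submonoid.coe_mul, inv_mul_cancel, Submonoid.coe_one, one_mul,
      su2_eq, Matrix.trace_fin_two]
    simp

lemma conj_expSU2 (g : SU2) (a : Fin 3 → ℝ) :
    g * expSU2 a * g⁻¹ =
      expSU2 (su2Coord ((g : Matrix (Fin 2) (Fin 2) ℂ) * su2 a * (g⁻¹ : SU2))) := by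
  apply Subtype.ext
  change (g : Matrix (Fin 2) (Fin 2) ℂ) * NormedSpace.exp (su2 a) * (g⁻¹ : SU2) =
    NormedSpace.exp (su2 _)
  rw [conj_su2]
  have h1 : (g : Matrix (Fin 2) (Fin 2) ℂ) * (g⁻¹ : SU2) = 1 := by
    rw [← Submonoid.coe_mul, mul_inv_cancel, Submonoid.coe_one]
  have h2 : ((g⁻¹ : SU2) : Matrix (Fin 2) (Fin 2) ℂ) * g = 1 := by
    rw [← Submonoid.coe_mul, inv_mul_cancel, Submonoid.coe_one]
  exact (Matrix.exp_units_conj ⟨_, _, h1, h2⟩ (su2 a)).symm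

lemma hasDerivAt_conj_exp {A : Type*} [NormedRing A] [NormedAlgebra ℝ A] [CompleteSpace A]
    (X Y : A) :
    HasDerivAt (fun t : ℝ => NormedSpace.exp (t • X) * Y * NormedSpace.exp (-(t • X)))
      (X * Y - Y * X) 0 := by
  have h1 : HasDerivAt (fun t : ℝ => NormedSpace.exp (t • X)) X 0 := by
    simpa using hasDerivAt_exp_smul_const (𝕂 := ℝ) X (0 : ℝ)
  have h2 : HasDerivAt (fun t : ℝ => NormedSpace.exp (-(t • X))) (-X) 0 := by
    simpa using hasDerivAt_exp_smul_const (𝕂 := ℝ) (-X) (0 : ℝ)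
  simpa [sub_eq_add_neg, Pi.mul_def] using (h1.mul_const Y).mul h2

-- The norm on matrices serves only to differentiate; composing with a linear map into `F` leaves a
-- statement free of it.
attribute [local instance] Matrix.linftyOpNormedRing Matrix.linftyOpNormedAlgebra in
lemma hasDerivAt_su2Coord_conj_exp {F : Type*} [NormedAddCommGroup F] [NormedSpace ℝ F]
    (D : (Fin 3 → ℝ) →L[ℝ] F) (X Y : Matrix (Fin 2) (Fin 2) ℂ) :
    HasDerivAt (fun t : ℝ =>
        D (su2Coord (NormedSpace.exp (t • X) * Y * NormedSpace.exp (-(t • X)))))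
      (D (su2Coord (X * Y - Y * X))) 0 := by
  have h := hasDerivAt_conj_exp X Y
  let T : Matrix (Fin 2) (Fin 2) ℂ →ₗ[ℝ] F := D.toLinearMap ∘ₗ su2Coord
  exact (LinearMap.toContinuousLinearMap T).hasFDerivAt.comp_hasDerivAt (0 : ℝ) h

attribute [local instance] Matrix.linftyOpNormedRing Matrix.linftyOpNormedAlgebra in
/-- The exponential of a multiple of a square root of `-1`. -/
lemma exp_smul_of_mul_self_eq_neg_one {X : Matrix (Fin 2) (Fin 2) ℂ} (hX : X * X = -1) (t : ℝ) :
    NormedSpace.exp (t • X) = Real.cos t • (1 : Matrix (Fin 2) (Fin 2) ℂ) + Real.sin t • X := by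
  -- The real algebra map from `ℂ` sending `I` to `X` carries Euler's formula over to matrices.
  have hc : Continuous (Complex.liftAux X hX) :=
    (Complex.liftAux X hX).toLinearMap.continuous_of_finiteDimensional
  have := NormedSpace.map_exp (Complex.liftAux X hX) hc (t * Complex.I)
  rw [← Complex.exp_eq_exp_ℂ] at this
  rw [Complex.liftAux_apply, Complex.liftAux_apply] at this
  simp only [Complex.exp_ofReal_mul_I_re, Algebra.algebraMap_eq_smul_one,
    Complex.exp_ofReal_mul_I_im, Complex.mul_re, Complex.ofReal_re, Complex.I_re, mul_zero,
    Complex.ofReal_im, Complex.I_im, mul_one, sub_self, zero_smul, Complex.mul_im, add_zero,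
    zero_add] at this
  exact this.symm

/-- Every element is `cos θ + sin θ X` with `X = -i u · σ` for a unit vector `u`, and then `X² =
-1`. This is what lets invariance under the generators imply invariance under the whole group. -/
lemma expSU2_surjective : Function.Surjective expSU2 := by
  intro g
  obtain ⟨G, hG⟩ := g
  have hG' := hG
  rw [Matrix.mem_specialUnitaryGroup_iff, Matrix.mem_unitaryGroup_iff] at hG
  obtain ⟨hU, hdet⟩ := hG
  have hadj : G.adjugate = star G := by
    calc G.adjugate = G.adjugate * (G * star G) := by rw [hU, mul_one]
      _ = star G := by rw [← mul_assoc, Matrix.adjugate_mul, hdet, one_smul, one_mul]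
  rw [Matrix.adjugate_fin_two] at hadj
  have h11 : G 1 1 = star (G 0 0) := by simpa using congrFun (congrFun hadj 0) 0
  have h10 : G 1 0 = - star (G 0 1) := by
    have := congrFun (congrFun hadj 1) 0
    simp at this
    rw [← neg_eq_iff_eq_neg]
    simpa using this
  have hn : (G 0 0).re ^ 2 + ((G 0 0).im ^ 2 + (G 0 1).re ^ 2 + (G 0 1).im ^ 2) = 1 := by
    rw [Matrix.det_fin_two, h11, h10] at hdet
    have := congrArg Complex.re hdet
    simp at this
    nlinarith
  set r := (G 0 0).im ^ 2 + (G 0 1).re ^ 2 + (G 0 1).im ^ 2 with hr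
  set c := (G 0 0).re with hc
  have hr0 : 0 ≤ r := by positivity
  have hG2 : G = !![G 0 0, G 0 1; - star (G 0 1), star (G 0 0)] := by
    rw [← h11, ← h10]
    exact Matrix.eta_fin_two G
  -- the angle
  set θ := Real.arccos c with hθ
  have hcos : Real.cos θ = c := Real.cos_arccos (by nlinarith) (by nlinarith)
  have hsin : Real.sin θ = √r := by
    rw [hθ, Real.sin_arccos]
    congr 1
    linarith
  -- the axis
  obtain ⟨u, hu, hus⟩ : ∃ u : Fin 3 → ℝ, u 0 ^ 2 + u 1 ^ 2 + u 2 ^ 2 = 1 ∧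
      √r * u 0 = -(G 0 1).im ∧ √r * u 1 = -(G 0 1).re ∧ √r * u 2 = -(G 0 0).im := by
    rcases hr0.eq_or_lt with h0 | h0
    -- Here the matrix is `±1` and any axis will do.
    · refine ⟨![1, 0, 0], by simp, ?_⟩
      have : (G 0 0).im = 0 ∧ (G 0 1).re = 0 ∧ (G 0 1).im = 0 := by
        refine ⟨?_, ?_, ?_⟩ <;> apply pow_eq_zero_iff (two_ne_zero) |>.1 <;>
        nlinarith [sq_nonneg (G 0 0).im, sq_nonneg (G 0 1).re, sq_nonneg (G 0 1).im]
      simp [this, ← h0]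
    · have hs : √r ≠ 0 := (Real.sqrt_pos.2 h0).ne'
      have hs2 : √r ^ 2 = r := Real.sq_sqrt hr0
      refine ⟨![-(G 0 1).im / √r, -(G 0 1).re / √r, -(G 0 0).im / √r], ?_, ?_, ?_, ?_⟩
      · simp only [Matrix.cons_val_zero, Matrix.cons_val_one, Matrix.cons_val]
        rw [div_pow, div_pow, div_pow, hs2]
        field_simp
        rw [hr]; ring
      all_goals
        simp
        field_simp
  have hX : su2 ((2 : ℝ) • u) * su2 ((2 : ℝ) • u) = -1 := by
    rw [su2_eq]
    ext i j
    fin_cases i <;> fin_cases j <;> apply Complex.ext <;>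
      simp [Matrix.mul_apply, Fin.sum_univ_two] <;> nlinarith
  refine ⟨θ • ((2 : ℝ) • u), Subtype.ext ?_⟩
  change NormedSpace.exp (su2 _) = G
  rw [su2_smul, exp_smul_of_mul_self_eq_neg_one hX, hcos, hsin, hG2, su2_eq]
  obtain ⟨h0, h1, h2⟩ := hus
  ext i j
  fin_cases i <;> fin_cases j <;> apply Complex.ext <;>
    simp <;> linarith

/-! ### The infinitesimal representation: commutation relations and irreducibility. -/

section Rep

variable {E : Type*} [NormedAddCommGroup E] [InnerProductSpace ℂ E] [CompleteSpace E]

lemma inExpCoordinates_zero (ρ : SU2 →* unitary (E →L[ℂ] E)) : inExpCoordinates ρ 0 = 1 := by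
  simp [inExpCoordinates, expSU2_zero]

lemma inExpCoordinates_add_smul (ρ : SU2 →* unitary (E →L[ℂ] E)) (s t : ℝ) (a : Fin 3 → ℝ) :
    inExpCoordinates ρ ((s + t) • a) =
      inExpCoordinates ρ (s • a) * inExpCoordinates ρ (t • a) := by
  simp [inExpCoordinates, expSU2_add_smul]

lemma star_inExpCoordinates (ρ : SU2 →* unitary (E →L[ℂ] E)) (a : Fin 3 → ℝ) :
    star (inExpCoordinates ρ a) = inExpCoordinates ρ (-a) := by
  rw [inExpCoordinates, inExpCoordinates, expSU2_neg, map_inv, ← Unitary.star_eq_inv,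
    Unitary.coe_star]

/-- The differential of a unitary representation at the identity, in exponential coordinates. -/
noncomputable def differential (ρ : SU2 →* unitary (E →L[ℂ] E)) : (Fin 3 → ℝ) →L[ℝ] (E →L[ℂ] E) :=
  fderiv ℝ (inExpCoordinates ρ) 0

lemma J_eq (ρ : SU2 →* unitary (E →L[ℂ] E)) (k : Fin 3) :
    J ρ k = Complex.I • differential ρ (Pi.single k 1) := rfl

variable {ρ : SU2 →* unitary (E →L[ℂ] E)}

lemma hasDerivAt_inExpCoordinates_zero (h : IsDifferentiable ρ) (a : Fin 3 → ℝ) :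
    HasDerivAt (fun t : ℝ => inExpCoordinates ρ (t • a)) (differential ρ a) 0 := by
  have h1 : HasDerivAt (fun t : ℝ => t • a) a 0 := by
    simpa using (hasDerivAt_id (0 : ℝ)).smul_const a
  have h2 : HasFDerivAt (inExpCoordinates ρ) (differential ρ) ((0 : ℝ) • a) := by
    rw [zero_smul]; exact DifferentiableAt.hasFDerivAt h
  exact h2.comp_hasDerivAt (0 : ℝ) h1

lemma hasDerivAt_inExpCoordinates (h : IsDifferentiable ρ) (a : Fin 3 → ℝ) (t : ℝ) :
    HasDerivAt (fun t : ℝ => inExpCoordinates ρ (t • a))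
      (inExpCoordinates ρ (t • a) * differential ρ a) t := by
  have h1 : HasDerivAt (fun s : ℝ => inExpCoordinates ρ (s • a)) (differential ρ a) (t - t) := by
    rw [sub_self]; exact hasDerivAt_inExpCoordinates_zero h a
  have h2 := (h1.comp_sub_const t t).const_mul (inExpCoordinates ρ (t • a))
  refine h2.congr_of_eventuallyEq (Filter.Eventually.of_forall fun s => ?_)
  simp only
  rw [← inExpCoordinates_add_smul, add_sub_cancel]

lemma star_differential (h : IsDifferentiable ρ) (a : Fin 3 → ℝ) :
    star (differential ρ a) = - differential ρ a := by
  have h1 := (hasDerivAt_inExpCoordinates_zero h a).star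
  have h2 := hasDerivAt_inExpCoordinates_zero h (-a)
  rw [map_neg] at h2
  refine h1.unique (h2.congr_of_eventuallyEq (Filter.Eventually.of_forall fun s => ?_))
  simp only [star_inExpCoordinates, smul_neg]

lemma isSelfAdjoint_J (h : IsDifferentiable ρ) (k : Fin 3) : IsSelfAdjoint (J ρ k) := by
  rw [IsSelfAdjoint, J_eq, star_smul, star_differential h]
  simp

/-- Both sides solve the same linear differential equation along `t • a`: multiplying by `exp (-t
D)` gives a function with zero derivative. -/
lemma inExpCoordinates_eq_exp (h : IsDifferentiable ρ) (a : Fin 3 → ℝ) :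
    inExpCoordinates ρ a = NormedSpace.exp (differential ρ a) := by
  set D := differential ρ a with hD
  have key : ∀ t : ℝ, HasDerivAt
      (fun t : ℝ => inExpCoordinates ρ (t • a) * NormedSpace.exp (t • -D)) 0 t := by
    intro t
    have := (hasDerivAt_inExpCoordinates h a t).mul
      (hasDerivAt_exp_smul_const' (𝕂 := ℝ) (-D) t)
    rw [← hD] at this
    rw [mul_assoc, ← mul_add, neg_mul, add_neg_cancel, mul_zero] at this
    exact this
  have hconst := is_const_of_deriv_eq_zero (fun t => (key t).differentiableAt)
    (fun t => (key t).deriv) 1 0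
  simp only [one_smul, zero_smul, NormedSpace.exp_zero, mul_one, inExpCoordinates_zero] at hconst
  have hinv : NormedSpace.exp (-D) * NormedSpace.exp D = 1 := by
    let +nondep : NormedAlgebra ℚ (E →L[ℂ] E) := NormedAlgebra.restrictScalars ℚ ℂ (E →L[ℂ] E)
    rw [← NormedSpace.exp_add_of_commute ((Commute.refl D).neg_left), neg_add_cancel,
      NormedSpace.exp_zero]
  calc inExpCoordinates ρ a
      = inExpCoordinates ρ a * (NormedSpace.exp (-D) * NormedSpace.exp D) := by rw [hinv, mul_one]
    _ = NormedSpace.exp D := by rw [← mul_assoc, hconst, one_mul]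

lemma conj_differential (h : IsDifferentiable ρ) (g : SU2) (a : Fin 3 → ℝ) :
    (ρ g : E →L[ℂ] E) * differential ρ a * (ρ g⁻¹ : E →L[ℂ] E) =
      differential ρ (su2Coord ((g : Matrix (Fin 2) (Fin 2) ℂ) * su2 a * (g⁻¹ : SU2))) := by
  set b := su2Coord ((g : Matrix (Fin 2) (Fin 2) ℂ) * su2 a * (g⁻¹ : SU2)) with hb
  have h1 := ((hasDerivAt_inExpCoordinates_zero h a).const_mul (ρ g : E →L[ℂ] E)).mul_const
    (ρ g⁻¹ : E →L[ℂ] E)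
  have h2 := hasDerivAt_inExpCoordinates_zero h b
  refine h1.unique (h2.congr_of_eventuallyEq (Filter.Eventually.of_forall fun t => ?_))
  simp only [inExpCoordinates]
  have : t • b = su2Coord ((g : Matrix (Fin 2) (Fin 2) ℂ) * su2 (t • a) * (g⁻¹ : SU2)) := by
    rw [hb, ← map_smul, su2_smul, mul_smul_comm, smul_mul_assoc]
  rw [this, ← conj_expSU2, map_mul, map_mul]
  rfl

/-- Take `g = exp (t a)` in `conj_differential` and differentiate both sides at `t = 0`. -/
lemma differential_commutator (h : IsDifferentiable ρ) (a b : Fin 3 → ℝ) :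
    differential ρ a * differential ρ b - differential ρ b * differential ρ a =
      differential ρ (su2Coord (su2 a * su2 b - su2 b * su2 a)) := by
  have h1 := hasDerivAt_su2Coord_conj_exp (differential ρ) (su2 a) (su2 b)
  have h2 := ((hasDerivAt_inExpCoordinates_zero h a).mul_const (differential ρ b)).mul
    (hasDerivAt_inExpCoordinates_zero h (-a))
  have h3 : differential ρ a * differential ρ b - differential ρ b * differential ρ a =
      differential ρ a * differential ρ b * inExpCoordinates ρ ((0 : ℝ) • -a) +
        inExpCoordinates ρ ((0 : ℝ) • a) * differential ρ b * differential ρ (-a) := by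
    simp [inExpCoordinates_zero, sub_eq_add_neg]
  rw [h3]
  refine h2.unique (h1.congr_of_eventuallyEq (Filter.Eventually.of_forall fun t => ?_))
  have := conj_differential h (expSU2 (t • a)) b
  rw [← expSU2_neg] at this
  change _ = differential ρ (su2Coord (NormedSpace.exp (su2 _) * su2 b *
    NormedSpace.exp (su2 _))) at this
  rw [show su2 (-(t • a)) = - su2 (t • a) by simpa using su2_smul (-1) (t • a), su2_smul] at this
  rw [Pi.mul_apply, smul_neg]
  exact this

lemma pauli_zero : pauli 0 = !![0, 1; 1, 0] := rfl

lemma pauli_one : pauli 1 = !![0, -Complex.I; Complex.I, 0] := rfl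

lemma pauli_two : pauli 2 = !![1, 0; 0, -1] := rfl

lemma su2_single (k : Fin 3) : su2 (Pi.single k 1) = (-(Complex.I / 2)) • pauli k := by
  rw [su2, Finset.sum_eq_single k]
  · simp
  · intro i _ hi
    simp [Pi.single_eq_of_ne hi]
  · simp

lemma J_commutator_of_su2 (h : IsDifferentiable ρ) {i j k : Fin 3}
    (hk : su2 (Pi.single i 1) * su2 (Pi.single j 1) - su2 (Pi.single j 1) * su2 (Pi.single i 1) =
      su2 (Pi.single k 1)) :
    J ρ i * J ρ j - J ρ j * J ρ i = Complex.I • J ρ k := by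
  have := differential_commutator h (Pi.single i 1) (Pi.single j 1)
  rw [hk, su2Coord_su2] at this
  simp only [J_eq, ← this, smul_mul_smul_comm, smul_smul, smul_sub]

lemma J_commutator_zero_one (h : IsDifferentiable ρ) :
    J ρ 0 * J ρ 1 - J ρ 1 * J ρ 0 = Complex.I • J ρ 2 := by
  refine J_commutator_of_su2 h ?_
  simp only [su2_single, pauli_zero, pauli_one, pauli_two]
  ext i j
  fin_cases i <;> fin_cases j <;> norm_num [Complex.ext_iff]

lemma J_commutator_one_two (h : IsDifferentiable ρ) :
    J ρ 1 * J ρ 2 - J ρ 2 * J ρ 1 = Complex.I • J ρ 0 := by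
  refine J_commutator_of_su2 h ?_
  simp only [su2_single, pauli_zero, pauli_one, pauli_two]
  ext i j
  fin_cases i <;> fin_cases j <;> norm_num [Complex.ext_iff]

lemma J_commutator_two_zero (h : IsDifferentiable ρ) :
    J ρ 2 * J ρ 0 - J ρ 0 * J ρ 2 = Complex.I • J ρ 1 := by
  refine J_commutator_of_su2 h ?_
  simp only [su2_single, pauli_zero, pauli_one, pauli_two]
  ext i j
  fin_cases i <;> fin_cases j <;> norm_num [Complex.ext_iff]

/-- A subspace that is invariant under the generators is trivial. -/
lemma eq_bot_or_eq_top_of_J_invariant [FiniteDimensional ℂ E] (h : IsDifferentiable ρ)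
    (hirr : (toRepresentation ρ).IsIrreducible) (W : Submodule ℂ E)
    (hW : ∀ k, ∀ w ∈ W, J ρ k w ∈ W) : W = ⊥ ∨ W = ⊤ := by
  have hD1 : ∀ k, ∀ w ∈ W, differential ρ (Pi.single k 1) w ∈ W := by
    intro k w hw
    have := W.smul_mem (-Complex.I) (hW k w hw)
    simpa [J_eq, smul_smul] using this
  have hD : ∀ a, ∀ w ∈ W, differential ρ a w ∈ W := by
    intro a w hw
    have ha : a = ∑ k, a k • (Pi.single k 1 : Fin 3 → ℝ) := by
      ext i
      simp [Finset.sum_apply, Pi.single_apply]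
    rw [ha, map_sum, sum_apply]
    refine W.sum_mem fun k _ => ?_
    rw [map_smul]
    change ((a k : ℝ) • (differential ρ (Pi.single k 1) w)) ∈ W
    rw [← Complex.coe_smul]
    exact W.smul_mem _ (hD1 k w hw)
  have hpow : ∀ a, ∀ m : ℕ, ∀ w ∈ W, (differential ρ a ^ m) w ∈ W := by
    intro a m
    induction m with
    | zero => intro w hw; simpa using hw
    | succ m ih => intro w hw; rw [pow_succ]; exact ih _ (hD a w hw)
  have hexp : ∀ a, ∀ w ∈ W, inExpCoordinates ρ a w ∈ W := by
    intro a w hw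
    rw [inExpCoordinates_eq_exp h]
    have hs := NormedSpace.exp_series_hasSum_exp' (𝕂 := ℂ) (differential ρ a)
    have hs' := (ContinuousLinearMap.apply ℂ E w).hasSum hs
    -- The partial sums of the exponential series stay in `W`, which is closed.
    refine W.closed_of_finiteDimensional.mem_of_tendsto hs'
      (Filter.Eventually.of_forall fun s => W.sum_mem fun m _ => ?_)
    exact W.smul_mem _ (hpow a m w hw)
  let V : Subrepresentation (toRepresentation ρ) :=
    { toSubmodule := W
      apply_mem_toSubmodule := by
        intro g v hv
        obtain ⟨a, rfl⟩ := expSU2_surjective g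
        exact hexp a v hv }
  rcases hirr.eq_bot_or_eq_top V with hV | hV
  · left; exact congrArg Subrepresentation.toSubmodule hV
  · right; exact congrArg Subrepresentation.toSubmodule hV

end Rep

/-! ### Weight bases of irreducible spin triples. -/

section Ladder

/-- The off-diagonal entry of `J_x` between the weight vectors `k - 1` and `k` in dimension `n`. -/
noncomputable def ladderCoeff (n k : ℕ) : ℝ := √((k : ℝ) * (n - k)) / 2

/-- The `k`-th weight `k - (n - 1) / 2` in dimension `n`. -/
noncomputable def weight (n k : ℕ) : ℝ := k - ((n : ℝ) - 1) / 2

variable {E : Type*} [NormedAddCommGroup E] [InnerProductSpace ℂ E] [CompleteSpace E]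

/-- An orthonormal weight basis `e 0, …, e (n - 1)` for a spin triple `X, Y, Z`, padded by zeros. -/
structure IsWeightBasis (n : ℕ) (X Y Z : E →L[ℂ] E) (e : ℕ → E) : Prop where
  orthonormal : Orthonormal ℂ (fun k : Fin n => e k)
  zero_of_le : ∀ k, n ≤ k → e k = 0
  apply_Z : ∀ k, Z (e k) = (weight n k : ℂ) • e k
  apply_X : ∀ k, X (e k) =
    (ladderCoeff n (k + 1) : ℂ) • e (k + 1) + (ladderCoeff n k : ℂ) • e (k - 1)
  apply_Y : ∀ k, Y (e k) = (-Complex.I) •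
    ((ladderCoeff n (k + 1) : ℂ) • e (k + 1) - (ladderCoeff n k : ℂ) • e (k - 1))

lemma inner_eq_zero_of_eigen {Z : E →L[ℂ] E} (hZ : IsSelfAdjoint Z) {v w : E} {a b : ℝ}
    (hv : Z v = (a : ℂ) • v) (hw : Z w = (b : ℂ) • w) (hab : a ≠ b) : inner ℂ v w = 0 := by
  have h : inner ℂ (Z v) w = inner ℂ v (Z w) := hZ.isSymmetric v w
  rw [hv, hw, inner_smul_left, inner_smul_right, Complex.conj_ofReal] at h
  have h2 : ((a : ℂ) - b) * inner ℂ v w = 0 := by linear_combination h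
  rcases mul_eq_zero.1 h2 with h3 | h3
  · exact absurd (by exact_mod_cast sub_eq_zero.1 h3) hab
  · exact h3

variable {X Y Z : E →L[ℂ] E}

/-- A self-adjoint operator on a nontrivial finite-dimensional space has a smallest eigenvalue. -/
lemma exists_min_eigenvector [FiniteDimensional ℂ E] [Nontrivial E] (hZ : IsSelfAdjoint Z) :
    ∃ (a : ℝ) (v : E), v ≠ 0 ∧ Z v = (a : ℂ) • v ∧
      ∀ (b : ℝ) (w : E), Z w = (b : ℂ) • w → b < a → w = 0 := by
  have hsymm : (Z : E →ₗ[ℂ] E).IsSymmetric := hZ.isSymmetric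
  let S : Set ℝ := {a | ∃ v : E, v ≠ 0 ∧ Z v = (a : ℂ) • v}
  have hfin : S.Finite := by
    refine ((Module.End.finite_hasEigenvalue (Z : E →ₗ[ℂ] E)).preimage
      (f := fun a : ℝ => (a : ℂ)) (Complex.ofReal_injective.injOn)).subset ?_
    rintro a ⟨v, hv, hva⟩
    exact Module.End.hasEigenvalue_of_hasEigenvector
      (Module.End.hasEigenvector_iff.2 ⟨Module.End.mem_eigenspace_iff.2 hva, hv⟩)
  have hne : S.Nonempty := by
    obtain ⟨c, hc⟩ := Module.End.exists_eigenvalue (Z : E →ₗ[ℂ] E)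
    obtain ⟨v, hv⟩ := hc.exists_hasEigenvector
    have hreal : (starRingEnd ℂ) c = c := hsymm.conj_eigenvalue_eq_self hc
    obtain ⟨r, hr⟩ := Complex.conj_eq_iff_real.1 hreal
    refine ⟨r, v, hv.2, ?_⟩
    rw [← hr]
    exact hv.apply_eq_smul
  obtain ⟨a, ⟨v, hv, hva⟩, hmin⟩ := S.exists_min_image id hfin hne
  refine ⟨a, v, hv, hva, fun b w hw hb => ?_⟩
  by_contra hw0
  exact absurd (hmin b ⟨w, hw0, hw⟩) (not_le.2 hb)

/-- Irreducible spin triples have weight bases. -/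
theorem exists_isWeightBasis [FiniteDimensional ℂ E] {n : ℕ} (hn : 1 ≤ n)
    (hdim : Module.finrank ℂ E = n)
    (hX : IsSelfAdjoint X) (hY : IsSelfAdjoint Y) (hZ : IsSelfAdjoint Z)
    (hXY : X * Y - Y * X = Complex.I • Z) (hYZ : Y * Z - Z * Y = Complex.I • X)
    (hZX : Z * X - X * Z = Complex.I • Y)
    (hirr : ∀ W : Submodule ℂ E, (∀ w ∈ W, X w ∈ W ∧ Y w ∈ W ∧ Z w ∈ W) → W = ⊥ ∨ W = ⊤) :
    ∃ e, IsWeightBasis n X Y Z e := by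
  have : Nontrivial E := Module.nontrivial_of_finrank_pos (R := ℂ) (by omega)
  obtain ⟨a, v, hv, hva, hmin⟩ := exists_min_eigenvector hZ
  -- raising and lowering operators
  set P : E →L[ℂ] E := X + Complex.I • Y with hP
  set M : E →L[ℂ] E := X - Complex.I • Y with hM
  have hI2 : Complex.I * Complex.I = -1 := Complex.I_mul_I
  have pXY : ∀ w, X (Y w) = Y (X w) + Complex.I • Z w := fun w => by
    have := congrArg (fun T : E →L[ℂ] E => T w) hXY
    simp only [sub_apply, mul_apply_eq_comp, smul_apply] at this
    rw [← this]; abel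
  have pYZ : ∀ w, Z (Y w) = Y (Z w) - Complex.I • X w := fun w => by
    have := congrArg (fun T : E →L[ℂ] E => T w) hYZ
    simp only [sub_apply, mul_apply_eq_comp, smul_apply] at this
    rw [← this]; abel
  have pZX : ∀ w, Z (X w) = X (Z w) + Complex.I • Y w := fun w => by
    have := congrArg (fun T : E →L[ℂ] E => T w) hZX
    simp only [sub_apply, mul_apply_eq_comp, smul_apply] at this
    rw [← this]; abel
  have hPw : ∀ w, P w = X w + Complex.I • Y w := fun w => rfl
  have hMw : ∀ w, M w = X w - Complex.I • Y w := fun w => rfl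
  have hZP : ∀ w, Z (P w) = P (Z w) + P w := fun w => by
    simp only [hPw, map_add, map_smul, pZX, pYZ, smul_sub, smul_smul, hI2]
    module
  have hZM : ∀ w, Z (M w) = M (Z w) - M w := fun w => by
    simp only [hMw, map_sub, map_smul, pZX, pYZ, smul_sub, smul_smul, hI2]
    module
  have hMP : ∀ w, M (P w) = P (M w) - (2 : ℂ) • Z w := fun w => by
    simp only [hMw, hPw, map_sub, map_add, map_smul, pXY, smul_sub, smul_add, smul_smul, hI2]
    module
  have hadj : ∀ x y, inner ℂ (P x) y = inner ℂ x (M y) := fun x y => by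
    have h1 : inner ℂ (X x) y = inner ℂ x (X y) := hX.isSymmetric x y
    have h2 : inner ℂ (Y x) y = inner ℂ x (Y y) := hY.isSymmetric x y
    rw [hPw, hMw, inner_add_left, inner_sub_right, inner_smul_left, inner_smul_right, h1, h2]
    simp [sub_eq_add_neg]
  -- the ladder
  let u : ℕ → E := fun k => (P ^ k) v
  have hu0 : u 0 = v := rfl
  have hus : ∀ k, u (k + 1) = P (u k) := fun k => by
    simp only [u, pow_succ', mul_apply_eq_comp]
  have huZ : ∀ k, Z (u k) = ((a + k : ℝ) : ℂ) • u k := by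
    intro k
    induction k with
    | zero => simpa [hu0] using hva
    | succ k ih =>
      rw [hus, hZP, ih, map_smul]
      push_cast
      module
  -- `M` lowers the eigenvalue of `Z` by one, and `a` is the smallest.
  have hMv : M v = 0 := by
    refine hmin (a - 1) _ ?_ (by linarith)
    rw [hZM, hva, map_smul]
    push_cast
    module
  have hMu : ∀ k, M (u (k + 1)) = (((k + 1 : ℝ) * (-2 * a - k) : ℝ) : ℂ) • u k := by
    intro k
    induction k with
    | zero =>
      rw [hus, hMP, hu0, hMv, map_zero, hva]
      push_cast
      module
    | succ k ih =>
      rw [hus (k + 1), hMP, ih, map_smul, ← hus, huZ]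
      push_cast
      module
  have horth : ∀ k l, k ≠ l → inner ℂ (u k) (u l) = 0 := fun k l hkl =>
    inner_eq_zero_of_eigen hZ (huZ k) (huZ l) (by
      intro h
      exact hkl (by exact_mod_cast (add_left_cancel h)))
  -- Otherwise there would be `n + 1` nonzero orthogonal vectors in dimension `n`.
  have hvanish : ∃ k, u k = 0 := by
    by_contra! hne
    have hli : LinearIndependent ℂ (fun k : Fin (n + 1) => u k) :=
      linearIndependent_of_ne_zero_of_inner_eq_zero (fun k => hne k)
        (fun k l hkl => horth k l (fun h => hkl (Fin.ext h)))
    have := hli.fintype_card_le_finrank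
    simp [hdim] at this
  classical
  let m := Nat.find hvanish
  have hm : u m = 0 := Nat.find_spec hvanish
  have hmlt : ∀ k, k < m → u k ≠ 0 := fun k hk => Nat.find_min hvanish hk
  have hmge : ∀ k, m ≤ k → u k = 0 := by
    intro k hk
    induction k, hk using Nat.le_induction with
    | base => exact hm
    | succ k _ ih => rw [hus, ih, map_zero]
  have hm0 : 0 < m := by
    rcases Nat.eq_zero_or_pos m with h | h
    · rw [h, hu0] at hm; exact absurd hm hv
    · exact h
  -- The ladder stops at `u m = 0` with `u (m - 1)` nonzero, so the coefficient of `hMu` must vanish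
  -- there; this determines the lowest weight.
  have ham : -2 * a = m - 1 := by
    obtain ⟨k, hk⟩ : ∃ k, m = k + 1 := ⟨m - 1, by omega⟩
    have h1 := hMu k
    rw [← hk, hm, map_zero] at h1
    have h2 := (smul_eq_zero.1 h1.symm).resolve_right (hmlt k (by omega))
    have h3 : ((k : ℝ) + 1) * (-2 * a - k) = 0 := by exact_mod_cast h2
    have h4 := (mul_eq_zero.1 h3).resolve_left (by positivity)
    rw [hk]; push_cast; linarith
  have hXu : ∀ w, X w = (1 / 2 : ℂ) • (P w + M w) := fun w => by rw [hPw, hMw]; module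
  have hYu : ∀ w, Y w = (-Complex.I / 2 : ℂ) • (P w - M w) := fun w => by
    have : Y w = (-(Complex.I * Complex.I)) • Y w := by rw [hI2]; module
    rw [hPw, hMw]
    conv_lhs => rw [this]
    module
  -- the span of the ladder is invariant
  set W := Submodule.span ℂ (Set.range u) with hW
  have huW : ∀ k, u k ∈ W := fun k => Submodule.subset_span ⟨k, rfl⟩
  have hPW : ∀ w ∈ W, P w ∈ W := fun w hw => by
    induction hw using Submodule.span_induction with
    | mem x hx => obtain ⟨k, rfl⟩ := hx; rw [← hus]; exact huW _
    | zero => simp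
    | add x y _ _ hx hy => rw [map_add]; exact W.add_mem hx hy
    | smul c x _ hx => rw [map_smul]; exact W.smul_mem c hx
  have hMW : ∀ w ∈ W, M w ∈ W := fun w hw => by
    induction hw using Submodule.span_induction with
    | mem x hx =>
      obtain ⟨k, rfl⟩ := hx
      rcases k with _ | k
      · rw [hu0, hMv]; exact W.zero_mem
      · rw [hMu]; exact W.smul_mem _ (huW _)
    | zero => simp
    | add x y _ _ hx hy => rw [map_add]; exact W.add_mem hx hy
    | smul c x _ hx => rw [map_smul]; exact W.smul_mem c hx
  have hZW : ∀ w ∈ W, Z w ∈ W := fun w hw => by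
    induction hw using Submodule.span_induction with
    | mem x hx => obtain ⟨k, rfl⟩ := hx; rw [huZ]; exact W.smul_mem _ (huW _)
    | zero => simp
    | add x y _ _ hx hy => rw [map_add]; exact W.add_mem hx hy
    | smul c x _ hx => rw [map_smul]; exact W.smul_mem c hx
  have hWtop : W = ⊤ := by
    refine (hirr W fun w hw => ⟨?_, ?_, hZW w hw⟩).resolve_left ?_
    · rw [hXu]; exact W.smul_mem _ (W.add_mem (hPW w hw) (hMW w hw))
    · rw [hYu]; exact W.smul_mem _ (W.sub_mem (hPW w hw) (hMW w hw))
    · intro hbot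
      have := huW 0
      rw [hbot, Submodule.mem_bot] at this
      exact hv this
  have hli : LinearIndependent ℂ (fun k : Fin m => u k) :=
    linearIndependent_of_ne_zero_of_inner_eq_zero (fun k => hmlt k k.2)
      (fun k l hkl => horth k l (fun h => hkl (Fin.ext h)))
  have hmn : m = n := by
    apply le_antisymm
    · simpa [hdim] using hli.fintype_card_le_finrank
    · have hspan : Submodule.span ℂ (Set.range fun k : Fin m => u k) = ⊤ := by
        rw [← hWtop, hW]
        apply le_antisymm
        · exact Submodule.span_mono (by rintro _ ⟨k, rfl⟩; exact ⟨k, rfl⟩)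
        · rw [Submodule.span_le]
          rintro _ ⟨k, rfl⟩
          by_cases hk : k < m
          · exact Submodule.subset_span ⟨⟨k, hk⟩, rfl⟩
          · rw [hmge k (by omega)]; exact Submodule.zero_mem _
      have := finrank_range_le_card (R := ℂ) (fun k : Fin m => u k)
      rw [Set.finrank, hspan, finrank_top, hdim] at this
      simpa using this
  rw [hmn] at hm0 hmlt hmge ham
  have hβ : ∀ k : ℕ, (k + 1 : ℝ) * (-2 * a - k) = ((k + 1 : ℕ) : ℝ) * (n - (k + 1 : ℕ)) := by
    intro k; rw [ham]; push_cast; ring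
  -- norms along the ladder
  have hnorm : ∀ k : ℕ, k + 1 ≤ n → ‖u (k + 1)‖ = 2 * ladderCoeff n (k + 1) * ‖u k‖ := by
    intro k hk
    have hk' : ((k + 1 : ℕ) : ℝ) ≤ n := by exact_mod_cast hk
    have h1 : (‖u (k + 1)‖ ^ 2 : ℝ) = ((k + 1 : ℕ) : ℝ) * (n - (k + 1 : ℕ)) * ‖u k‖ ^ 2 := by
      have h2 : inner ℂ (u (k + 1)) (u (k + 1)) =
          (((((k + 1 : ℕ) : ℝ) * (n - (k + 1 : ℕ))) : ℝ) : ℂ) * inner ℂ (u k) (u k) := by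
        conv_lhs => rw [hus k, hadj, ← hus, hMu, inner_smul_right, hβ]
      have h3 : ∀ x : E, (inner ℂ x x).re = ‖x‖ ^ 2 := fun x => inner_self_eq_norm_sq (𝕜 := ℂ) x
      have h4 := congrArg Complex.re h2
      rwa [Complex.re_ofReal_mul, h3, h3] at h4
    have h3 : 0 ≤ ((k + 1 : ℕ) : ℝ) * (n - (k + 1 : ℕ)) :=
      mul_nonneg (Nat.cast_nonneg _) (sub_nonneg.2 hk')
    rw [← Real.sqrt_sq (norm_nonneg (u (k + 1))), h1, Real.sqrt_mul h3,
      Real.sqrt_sq (norm_nonneg _), ladderCoeff]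
    ring
  -- Past the top `u k = 0`, and the junk value `0⁻¹ = 0` is harmless.
  let e : ℕ → E := fun k => ((‖u k‖⁻¹ : ℝ) : ℂ) • u k
  have hPe : ∀ k, P (e k) = ((2 * ladderCoeff n (k + 1) : ℝ) : ℂ) • e (k + 1) := by
    intro k
    simp only [e, map_smul, ← hus, smul_smul]
    by_cases hk : k + 1 < n
    · have h1 := hnorm k (by omega)
      have h2 : ‖u (k + 1)‖ ≠ 0 := norm_ne_zero_iff.2 (hmlt _ hk)
      have h3 : ‖u k‖ ≠ 0 := norm_ne_zero_iff.2 (hmlt _ (by omega))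
      congr 1
      rw [← Complex.ofReal_mul]
      congr 1
      rw [h1] at h2 ⊢
      have h4 : 2 * ladderCoeff n (k + 1) ≠ 0 := left_ne_zero_of_mul h2
      rw [mul_inv, ← mul_assoc, mul_inv_cancel₀ h4, one_mul]
    · rw [hmge (k + 1) (by omega)]; simp
  have hMe : ∀ k, M (e k) = ((2 * ladderCoeff n k : ℝ) : ℂ) • e (k - 1) := by
    intro k
    rcases k with _ | k
    -- The truncated `0 - 1` does no harm because `ladderCoeff n 0 = 0`.
    · simp [e, hu0, hMv, ladderCoeff]
    · simp only [e, map_smul, hMu, smul_smul, Nat.add_sub_cancel]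
      by_cases hk : k + 1 < n
      · have h1 := hnorm k (by omega)
        have h2 : ‖u (k + 1)‖ ≠ 0 := norm_ne_zero_iff.2 (hmlt _ hk)
        have h3 : ‖u k‖ ≠ 0 := norm_ne_zero_iff.2 (hmlt _ (by omega))
        have hk' : ((k + 1 : ℕ) : ℝ) ≤ n := by exact_mod_cast hk.le
        have h5 : 0 ≤ ((k + 1 : ℕ) : ℝ) * (n - (k + 1 : ℕ)) :=
          mul_nonneg (Nat.cast_nonneg _) (sub_nonneg.2 hk')
        have h6 : ((k + 1 : ℕ) : ℝ) * (n - (k + 1 : ℕ)) = (2 * ladderCoeff n (k + 1)) ^ 2 := by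
          rw [ladderCoeff, mul_div_cancel₀ _ (two_ne_zero), Real.sq_sqrt h5]
        congr 1
        rw [← Complex.ofReal_mul, ← Complex.ofReal_mul]
        congr 1
        rw [hβ, h6]
        rw [h1] at h2 ⊢
        have h4 : 2 * ladderCoeff n (k + 1) ≠ 0 := left_ne_zero_of_mul h2
        rw [mul_inv, sq]
        field_simp
      · rw [hmge (k + 1) (by omega)]
        -- The left side is zero. On the right, the coefficient vanishes when `n = k + 1`, and the
        -- vector vanishes beyond that.
        rcases Nat.lt_or_ge k n with hkn | hkn
        · have : n = k + 1 := by omega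
          simp [ladderCoeff, this]
        · rw [hmge k hkn]; simp
  refine ⟨e, ?_, ?_, ?_, ?_, ?_⟩
  · rw [orthonormal_iff_ite]
    intro k l
    by_cases hkl : k = l
    · subst hkl
      have h3 : ‖u k‖ ≠ 0 := norm_ne_zero_iff.2 (hmlt _ k.2)
      rw [if_pos rfl, inner_self_eq_norm_sq_to_K]
      simp [e, norm_smul, h3]
    · rw [if_neg hkl]
      simp only [e, inner_smul_left, inner_smul_right]
      rw [horth _ _ (fun h => hkl (Fin.ext h))]
      simp
  · intro k hk
    simp [e, hmge k hk]
  · intro k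
    simp only [e, map_smul, huZ, smul_smul, weight]
    rw [show a + (k : ℝ) = k - ((n : ℝ) - 1) / 2 by linarith, mul_comm]
  · intro k
    rw [hXu, hPe, hMe]
    push_cast
    module
  · intro k
    rw [hYu, hPe, hMe]
    push_cast
    module

end Ladder

/-! ### Wallis bounds for central binomial coefficients. -/

section CentralBinomial

/-- The normalized central binomial coefficient `binom(2k, k) / 4^k`. -/
noncomputable def centralRatio (k : ℕ) : ℝ := (Nat.centralBinom k : ℝ) / 4 ^ k

lemma centralRatio_pos (k : ℕ) : 0 < centralRatio k := by
  have := Nat.centralBinom_pos k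
  unfold centralRatio
  positivity

lemma centralRatio_zero : centralRatio 0 = 1 := by simp [centralRatio]

lemma centralRatio_succ (k : ℕ) :
    (2 * k + 2) * centralRatio (k + 1) = (2 * k + 1) * centralRatio k := by
  have h : ((k : ℝ) + 1) * Nat.centralBinom (k + 1) = 2 * (2 * k + 1) * Nat.centralBinom k := by
    exact_mod_cast Nat.succ_mul_centralBinom_succ k
  unfold centralRatio
  rw [pow_succ]
  field_simp
  linear_combination 2 * h

/-- The ratio is the product of the `(2i - 1) / (2i)` for `1 ≤ i ≤ k`, whose square times `2k + 1`
is the reciprocal of the Wallis product. -/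
lemma wallis_mul_centralRatio_sq (k : ℕ) :
    Real.Wallis.W k * ((2 * k + 1) * centralRatio k ^ 2) = 1 := by
  induction k with
  | zero => simp [Real.Wallis.W, centralRatio_zero]
  | succ k ih =>
    have h := centralRatio_succ k
    have h' : centralRatio k = (2 * k + 2) * centralRatio (k + 1) / (2 * k + 1) := by
      rw [h]; field_simp
    rw [h'] at ih
    rw [Real.Wallis.W_succ]
    refine Eq.trans ?_ ih
    push_cast
    field_simp
    ring

lemma le_centralRatio_sq (k : ℕ) : 2 / (Real.pi * (2 * k + 1)) ≤ centralRatio k ^ 2 := by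
  have h1 := wallis_mul_centralRatio_sq k
  have h2 := Real.Wallis.W_le k
  have h3 : 0 ≤ (2 * (k : ℝ) + 1) * centralRatio k ^ 2 := by positivity
  have h4 := mul_le_mul_of_nonneg_right h2 h3
  rw [h1] at h4
  have hpi := Real.pi_pos
  rw [div_le_iff₀ (by positivity)]
  linarith

/-- By the AM-GM inequality `(2i + 1)(2k + 1) ≤ (i + k + 1)²`. The bound depends only on `i + k`,
hence is uniform along a middle column of the overlaps. -/
lemma le_centralRatio_mul (i k : ℕ) :
    2 / (Real.pi * (i + k + 1)) ≤ centralRatio i * centralRatio k := by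
  have hpi := Real.pi_pos
  have hi := le_centralRatio_sq i
  have hk := le_centralRatio_sq k
  have hpos := mul_pos (centralRatio_pos i) (centralRatio_pos k)
  refine le_of_sq_le_sq ?_ hpos.le
  rw [mul_pow]
  refine le_trans ?_ (mul_le_mul hi hk (by positivity) (by positivity))
  rw [div_pow, div_mul_div_comm, div_le_div_iff₀ (by positivity) (by positivity)]
  have : 0 ≤ Real.pi ^ 2 * ((i : ℝ) - k) ^ 2 := by positivity
  nlinarith

end CentralBinomial

/-! ### Recurrences for the overlaps and their solution in the extreme row. -/

section Overlap

open ComplexConjugate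

lemma weight_add (n k l : ℕ) : weight n k + weight n l = k + l - (n - 1) := by
  simp only [weight]; ring

lemma weight_sub (n k l : ℕ) : weight n k - weight n l = k - l := by
  simp only [weight]; ring

lemma ladderCoeff_zero (n : ℕ) : ladderCoeff n 0 = 0 := by simp [ladderCoeff]

lemma two_mul_ladderCoeff_sq {n k : ℕ} (hk : k ≤ n) :
    (2 * ladderCoeff n k) ^ 2 = k * (n - k) := by
  have : (k : ℝ) ≤ n := by exact_mod_cast hk
  rw [ladderCoeff, mul_div_cancel₀ _ two_ne_zero,
    Real.sq_sqrt (mul_nonneg (Nat.cast_nonneg _) (sub_nonneg.2 this))]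

lemma ladderCoeff_pos {n k : ℕ} (h0 : 0 < k) (hk : k < n) : 0 < ladderCoeff n k := by
  have h1 : (k : ℝ) < n := by exact_mod_cast hk
  have h2 : (0 : ℝ) < k := by exact_mod_cast h0
  exact div_pos (Real.sqrt_pos.2 (mul_pos h2 (sub_pos.2 h1))) two_pos

lemma ladderCoeff_ne_zero {n k : ℕ} (h0 : 0 < k) (hk : k < n) : (ladderCoeff n k : ℂ) ≠ 0 :=
  Complex.ofReal_ne_zero.2 (ladderCoeff_pos h0 hk).ne'

lemma norm_sq_of_ladder {n k : ℕ} (hk : k ≤ n) {x y : ℂ} {r : ℝ}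
    (h : 2 * (ladderCoeff n k : ℂ) * x = r * y) :
    k * (n - k) * ‖x‖ ^ 2 = r ^ 2 * ‖y‖ ^ 2 := by
  have h1 : ((2 * ladderCoeff n k : ℝ) : ℂ) * x = r * y := by rw [← h]; push_cast; ring
  have h2 := congrArg (fun z => ‖z‖ ^ 2) h1
  simp only [norm_mul, mul_pow, Complex.norm_real, Real.norm_eq_abs, sq_abs] at h2
  rw [← two_mul_ladderCoeff_sq hk]
  linear_combination h2

/-- The relations between the overlaps `⟨e_k, f_l⟩` of the weight bases of `J_z` and `J_x`. -/
structure IsOverlap (n : ℕ) (M : ℕ → ℕ → ℂ) : Prop where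
  left : ∀ k l, (weight n l : ℂ) * M k l =
    ladderCoeff n (k + 1) * M (k + 1) l + ladderCoeff n k * M (k - 1) l
  right : ∀ k l, (weight n k : ℂ) * M k l =
    ladderCoeff n (l + 1) * M k (l + 1) + ladderCoeff n l * M k (l - 1)
  mixed : ∀ k l, (ladderCoeff n (k + 1) : ℂ) * M (k + 1) l - ladderCoeff n k * M (k - 1) l =
    ladderCoeff n (l + 1) * M k (l + 1) - ladderCoeff n l * M k (l - 1)
  sum_norm_sq : ∑ k ∈ Finset.range n, ‖M k 0‖ ^ 2 = 1

namespace IsOverlap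

variable {n : ℕ} {M : ℕ → ℕ → ℂ}

/-- Adding the three relations cancels two of the four neighbours of `(k, l)`. Other sign choices
give `left_succ` and `left_succ'`. -/
lemma right_succ (hM : IsOverlap n M) (k l : ℕ) : 2 * (ladderCoeff n (l + 1) : ℂ) * M k (l + 1) =
    ((weight n k + weight n l : ℝ) : ℂ) * M k l - 2 * ladderCoeff n k * M (k - 1) l := by
  push_cast
  linear_combination -hM.left k l - hM.right k l - hM.mixed k l

lemma left_succ (hM : IsOverlap n M) (k l : ℕ) : 2 * (ladderCoeff n (k + 1) : ℂ) * M (k + 1) l =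
    ((weight n k + weight n l : ℝ) : ℂ) * M k l - 2 * ladderCoeff n l * M k (l - 1) := by
  push_cast
  linear_combination -hM.left k l - hM.right k l + hM.mixed k l

lemma left_succ' (hM : IsOverlap n M) (k l : ℕ) : 2 * (ladderCoeff n (k + 1) : ℂ) * M (k + 1) l =
    ((weight n l - weight n k : ℝ) : ℂ) * M k l + 2 * ladderCoeff n (l + 1) * M k (l + 1) := by
  push_cast
  linear_combination -hM.left k l + hM.right k l + hM.mixed k l

/-- Squaring the recurrence gives the ratio `(n - 1 - l) / (l + 1)` of consecutive binomial
coefficients. -/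
lemma norm_sq_eq_choose {x : ℕ → ℂ}
    (h : ∀ l, 2 * (ladderCoeff n (l + 1) : ℂ) * x (l + 1) = ((l - (n - 1) : ℝ) : ℂ) * x l) :
    ∀ l, l < n → ‖x l‖ ^ 2 = (n - 1).choose l * ‖x 0‖ ^ 2 := by
  intro l
  induction l with
  | zero => simp
  | succ l ih =>
    intro hl
    have h1 := norm_sq_of_ladder hl.le (h l)
    have h2 : (((n - 1).choose (l + 1) * (l + 1) : ℕ) : ℝ) = ((n - 1).choose l * (n - 1 - l) : ℕ) :=
      congrArg _ (Nat.choose_succ_right_eq (n - 1) l)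
    rw [ih (by omega)] at h1
    obtain ⟨d, rfl⟩ : ∃ d, n = l + 2 + d := ⟨n - (l + 2), by omega⟩
    rw [show l + 2 + d - 1 = l + 1 + d by omega] at h1 h2 ⊢
    rw [show l + 1 + d - l = d + 1 by omega] at h2
    push_cast at h1 h2 ⊢
    have hd : ((l : ℝ) + 1) * (d + 1) ≠ 0 := by positivity
    apply mul_left_cancel₀ hd
    linear_combination h1 - (d + 1) * ‖x 0‖ ^ 2 * h2

/-- Row `0` and column `0` are both binomial multiples of the corner; normalizing the column fixes
the corner at `2 ^ -(n - 1)`, the starting value for the middle columns. -/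
lemma norm_sq_zero_row (hM : IsOverlap n M) {l : ℕ} (hl : l < n) :
    ‖M 0 l‖ ^ 2 = (n - 1).choose l / 2 ^ (n - 1) := by
  have hrow : ∀ l, l < n → ‖M 0 l‖ ^ 2 = (n - 1).choose l * ‖M 0 0‖ ^ 2 := by
    refine norm_sq_eq_choose (x := fun l => M 0 l) fun l => ?_
    rw [hM.right_succ 0 l, ladderCoeff_zero, weight_add]
    push_cast; ring
  have hcol : ∀ l, l < n → ‖M l 0‖ ^ 2 = (n - 1).choose l * ‖M 0 0‖ ^ 2 := by
    refine norm_sq_eq_choose (x := fun l => M l 0) fun l => ?_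
    rw [hM.left_succ l 0, ladderCoeff_zero, weight_add]
    push_cast; ring
  have hsum := hM.sum_norm_sq
  rw [Finset.sum_congr rfl fun k hk => hcol k (Finset.mem_range.1 hk), ← Finset.sum_mul,
    ← Nat.cast_sum] at hsum
  have h2 : ∑ k ∈ Finset.range n, (n - 1).choose k = 2 ^ (n - 1) := by
    conv_lhs => rw [show n = n - 1 + 1 by omega]
    exact Nat.sum_range_choose (n - 1)
  rw [h2] at hsum
  push_cast at hsum
  rw [hrow l hl, eq_div_iff (by positivity)]
  linear_combination ((n - 1).choose l : ℝ) * hsum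

end IsOverlap

/-! ### The middle column in odd dimension. -/

section OddDimension

variable {j : ℕ} {M : ℕ → ℕ → ℂ}

/-- The middle weight is zero, so the column is in the kernel of a tridiagonal matrix with zero
diagonal. The recurrence then moves in steps of two: odd entries inherit zero from the first, and
even ones follow the ratios of `centralRatio_succ`. -/
lemma IsOverlap.odd_column (hM : IsOverlap (2 * j + 1) M) : ∀ i ≤ j,
    ‖M (2 * i) j‖ ^ 2 = centralRatio i * centralRatio (j - i) ∧
      (i < j → M (2 * i + 1) j = 0) := by
  have hw : weight (2 * j + 1) j = 0 := by simp only [weight]; push_cast; ring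
  have hrec : ∀ k, (ladderCoeff (2 * j + 1) (k + 1) : ℂ) * M (k + 1) j =
      -(ladderCoeff (2 * j + 1) k * M (k - 1) j) := by
    intro k
    have := hM.left k j
    rw [hw] at this
    push_cast at this
    linear_combination -this
  intro i
  induction i with
  | zero =>
    intro _
    constructor
    · have := hM.norm_sq_zero_row (l := j) (by omega)
      rw [mul_zero, this, centralRatio_zero, one_mul, Nat.sub_zero, centralRatio, Nat.centralBinom,
        Nat.add_sub_cancel, pow_mul]
      norm_num
    · intro hj
      have := hrec 0
      rw [ladderCoeff_zero, Complex.ofReal_zero, zero_mul, neg_zero] at this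
      exact (mul_eq_zero.1 this).resolve_left (ladderCoeff_ne_zero (by omega) (by omega))
  | succ i ih =>
    intro hi
    obtain ⟨ih1, ih2⟩ := ih (by omega)
    constructor
    · have h1 := congrArg (fun z => ‖z‖ ^ 2) (hrec (2 * i + 1))
      simp only [norm_mul, mul_pow, Complex.norm_real, Real.norm_eq_abs, sq_abs, norm_neg,
        Nat.add_sub_cancel, ih1] at h1
      have c1 := two_mul_ladderCoeff_sq (n := 2 * j + 1) (k := 2 * i + 1) (by omega)
      have c2 := two_mul_ladderCoeff_sq (n := 2 * j + 1) (k := 2 * i + 1 + 1) (by omega)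
      obtain ⟨d, rfl⟩ : ∃ d, j = i + 1 + d := ⟨j - (i + 1), by omega⟩
      rw [show i + 1 + d - i = d + 1 by omega] at h1
      rw [show i + 1 + d - (i + 1) = d by omega, show 2 * (i + 1) = 2 * i + 1 + 1 by ring]
      have p1 := centralRatio_succ i
      have p2 := centralRatio_succ d
      push_cast at c1 c2
      have hd : (2 * (i : ℝ) + 2) * (2 * d + 1) ≠ 0 := by positivity
      apply mul_left_cancel₀ hd
      linear_combination 4 * h1 - ‖M (2 * i + 1 + 1) (i + 1 + d)‖ ^ 2 * c2 +
        centralRatio i * centralRatio (d + 1) * c1 + (2 * i + 1) * centralRatio i * p2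
        - (2 * d + 1) * centralRatio d * p1
    · intro hj
      have := hrec (2 * i + 2)
      rw [show 2 * i + 2 - 1 = 2 * i + 1 by omega, ih2 (by omega), mul_zero, neg_zero] at this
      exact (mul_eq_zero.1 this).resolve_left (ladderCoeff_ne_zero (by omega) (by omega))

end OddDimension

/-! ### The two middle columns in even dimension. -/

section EvenDimension

variable {m : ℕ} {M : ℕ → ℕ → ℂ}

lemma two_mul_ladderCoeff_half (m : ℕ) : 2 * ladderCoeff (2 * m) m = m := by
  rw [ladderCoeff, mul_div_cancel₀ _ two_ne_zero]
  push_cast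
  rw [show (m : ℝ) * (2 * m - m) = m ^ 2 by ring, Real.sqrt_sq (Nat.cast_nonneg m)]

lemma two_mul_ladderCoeff_half_complex (m : ℕ) : 2 * (ladderCoeff (2 * m) m : ℂ) = m := by
  exact_mod_cast congrArg (fun x : ℝ => (x : ℂ)) (two_mul_ladderCoeff_half m)

/-- The weights `-1/2` and `1/2` are exchanged by a symmetry. Concretely, `left_succ` in column `m`
and `left_succ'` in column `m - 1` couple only these two columns, and the sign passes through the
induction. -/
lemma IsOverlap.even_symm (hm : 0 < m) (hM : IsOverlap (2 * m) M) :
    ∀ k < 2 * m, M k (m - 1) = -(-1) ^ k * M k m := by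
  have hc := two_mul_ladderCoeff_half_complex m
  have hm1 : m - 1 + 1 = m := by omega
  have hmc : ((m - 1 : ℕ) : ℝ) = m - 1 := by
    rw [Nat.cast_sub (by omega), Nat.cast_one]
  intro k
  induction k with
  | zero =>
    intro _
    have h := hM.right_succ 0 (m - 1)
    rw [hm1, hc, ladderCoeff_zero, weight_add, hmc] at h
    push_cast at h
    have hmne : (m : ℂ) ≠ 0 := by exact_mod_cast hm.ne'
    apply mul_left_cancel₀ hmne
    linear_combination h
  | succ k ih =>
    intro hk
    have ihk := ih (by omega)
    have h1 := hM.left_succ k m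
    have h2 := hM.left_succ' k (m - 1)
    rw [weight_add, hc] at h1
    rw [weight_sub, hm1, hc, hmc] at h2
    have hwk : weight (2 * m) k = k - (2 * m - 1) / 2 := by simp [weight]
    rw [ihk] at h1 h2
    have hne := ladderCoeff_ne_zero (n := 2 * m) (k := k + 1) (by omega) hk
    apply mul_left_cancel₀ (mul_ne_zero (two_ne_zero' ℂ) hne)
    have hs : ((-1 : ℂ) ^ k) * (-1) ^ k = 1 := by rw [← mul_pow]; simp
    push_cast at h1 h2
    rw [pow_succ]
    linear_combination h2 - (-1) ^ k * h1 - (m : ℂ) * M k m * hs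

/-- The symmetry closes the recurrence on column `m`, with factor `k + 1` for even `k` and `k + 1 -
2m` for odd `k`. -/
lemma IsOverlap.even_step (hm : 0 < m) (hM : IsOverlap (2 * m) M) {k : ℕ} (hk : k < 2 * m) :
    2 * (ladderCoeff (2 * m) (k + 1) : ℂ) * M (k + 1) m =
      ((k + 1 - m + (-1) ^ k * m : ℝ) : ℂ) * M k m := by
  rw [hM.left_succ k m, two_mul_ladderCoeff_half_complex, hM.even_symm hm k hk, weight_add]
  push_cast
  ring

lemma IsOverlap.even_column (hM : IsOverlap (2 * m) M) : ∀ i < m,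
    m * ‖M (2 * i) m‖ ^ 2 = centralRatio i * centralRatio (m - i) * (m - i) ∧
    m * ‖M (2 * i + 1) m‖ ^ 2 = centralRatio (i + 1) * centralRatio (m - (i + 1)) * (i + 1) := by
  have hodd : ∀ i < m, m * ‖M (2 * i) m‖ ^ 2 = centralRatio i * centralRatio (m - i) * (m - i) →
      m * ‖M (2 * i + 1) m‖ ^ 2 =
        centralRatio (i + 1) * centralRatio (m - (i + 1)) * (i + 1) := by
    intro i hi h
    have h1 := norm_sq_of_ladder (by omega) (hM.even_step (by omega) (k := 2 * i) (by omega))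
    obtain ⟨d, rfl⟩ : ∃ d, m = i + 1 + d := ⟨m - (i + 1), by omega⟩
    rw [show i + 1 + d - i = d + 1 by omega] at h
    rw [show i + 1 + d - (i + 1) = d by omega]
    have p1 := centralRatio_succ i
    have p2 := centralRatio_succ d
    rw [pow_mul, neg_one_sq, one_pow] at h1
    push_cast at h h1 ⊢
    have hd : (2 * (i : ℝ) + 1) * (2 * d + 1) ≠ 0 := by positivity
    apply mul_left_cancel₀ hd
    linear_combination (i + 1 + d : ℝ) * h1 + (2 * i + 1) ^ 2 * h
      + (2 * i + 1) ^ 2 / 2 * centralRatio i * p2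
      - (2 * i + 1) * (2 * d + 1) / 2 * centralRatio d * p1
  have heven : ∀ i < m, m * ‖M (2 * i) m‖ ^ 2 =
      centralRatio i * centralRatio (m - i) * (m - i) := by
    intro i
    induction i with
    | zero =>
      intro hm
      have h := hM.norm_sq_zero_row (l := m) (by omega)
      rw [mul_zero, h, centralRatio_zero, Nat.sub_zero, centralRatio]
      have hcb : (Nat.centralBinom m : ℝ) = 2 * (2 * m - 1).choose m := by
        obtain ⟨d, rfl⟩ : ∃ d, m = d + 1 := ⟨m - 1, by omega⟩
        rw [show 2 * (d + 1) - 1 = 2 * d + 1 by omega]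
        have h2 : (2 * d + 1).choose d = (2 * d + 1).choose (d + 1) :=
          Nat.choose_symm_of_eq_add (by omega)
        rw [Nat.centralBinom, show 2 * (d + 1) = 2 * d + 1 + 1 by ring, Nat.choose_succ_succ, h2]
        push_cast; ring
      have h4 : (4 : ℝ) ^ m = 2 * 2 ^ (2 * m - 1) := by
        rw [← pow_succ', show 2 * m - 1 + 1 = 2 * m by omega, pow_mul]
        norm_num
      rw [hcb, h4]
      push_cast
      field_simp
      ring
    | succ i ih =>
      intro hi
      have h := hodd i (by omega) (ih (by omega))
      have h1 := norm_sq_of_ladder (by omega) (hM.even_step (by omega) (k := 2 * i + 1) (by omega))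
      obtain ⟨d, rfl⟩ : ∃ d, m = i + 2 + d := ⟨m - (i + 2), by omega⟩
      rw [show i + 2 + d - (i + 1) = d + 1 by omega] at h ⊢
      rw [Odd.neg_one_pow ⟨i, rfl⟩] at h1
      rw [show 2 * (i + 1) = 2 * i + 1 + 1 by ring]
      push_cast at h h1 ⊢
      have hd : (4 : ℝ) * ((i : ℝ) + 1) * (d + 1) ≠ 0 := by positivity
      apply mul_left_cancel₀ hd
      linear_combination (i + 2 + d : ℝ) * h1 + 4 * (d + 1) ^ 2 * h
  exact fun i hi => ⟨heven i hi, hodd i hi (heven i hi)⟩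

end EvenDimension

end Overlap

open ComplexConjugate

/-! ### Rank one between odd and even indices. -/

section Factorization

lemma le_mul_of_le_sq {d x y : ℝ} (hx : 0 ≤ x) (hy : 0 ≤ y) (hdx : d ≤ x ^ 2)
    (hdy : d ≤ y ^ 2) : d ≤ x * y := by
  rcases le_total x y with h | h
  · exact hdx.trans (by rw [sq]; gcongr)
  · exact hdy.trans (by rw [sq]; gcongr)

/-- Up to the factor `k - k'`, the block of `1_{(0,∞)}(J_x)` between odd and even weight vectors
of `J_z` has rank one, with entries of modulus about `1 / π` near the middle. -/
lemma IsOverlap.exists_factorization {n : ℕ} {M : ℕ → ℕ → ℂ} (hn : 2 ≤ n) (hM : IsOverlap n M) :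
    ∃ g h : ℕ → ℂ, ∀ k k', Odd k → Even k' → k < n → k' < n →
      (ladderCoeff n ((n + 1) / 2) : ℂ) *
        (M k ((n + 1) / 2 - 1) * conj (M k' ((n + 1) / 2)) -
          M k ((n + 1) / 2) * conj (M k' ((n + 1) / 2 - 1))) = g k * h k' ∧
      ∀ B : ℝ, 0 ≤ B → B ≤ k → B ≤ n - k → B ≤ n - k' →
        2 * B ≤ Real.pi * (n + 2) * (‖g k‖ * ‖h k'‖) := by
  have hpi := Real.pi_pos
  rcases Nat.even_or_odd' n with ⟨m, rfl | rfl⟩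
  · have hm : 0 < m := by omega
    rw [show (2 * m + 1) / 2 = m by omega]
    -- By `even_symm` column `m - 1` equals column `m` at odd indices and its negative at even ones,
    -- so the two terms add up, with `2 * ladderCoeff (2 * m) m = m`.
    refine ⟨fun k => m * M k m, fun k' => conj (M k' m), ?_⟩
    intro k k' hk hk' hkn hkn'
    refine ⟨?_, ?_⟩
    · rw [hM.even_symm hm k hkn, hM.even_symm hm k' hkn', hk.neg_one_pow, hk'.neg_one_pow]
      have hc := two_mul_ladderCoeff_half_complex m
      simp only [map_mul, map_neg, map_one]
      linear_combination M k m * conj (M k' m) * hc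
    · intro B hB hBk _ hBk'
      obtain ⟨i, rfl⟩ := hk
      obtain ⟨i', rfl⟩ := hk'
      have h1 := (hM.even_column i (by omega)).2
      have h2 := (hM.even_column i' (by omega)).1
      have h3 := le_centralRatio_mul (i + 1) (m - (i + 1))
      have h4 := le_centralRatio_mul i' (m - i')
      rw [Nat.cast_sub (by omega)] at h3 h4
      rw [show ((i + 1 : ℕ) : ℝ) + ((m : ℝ) - (i + 1 : ℕ)) = m by ring] at h3
      rw [show (i' : ℝ) + ((m : ℝ) - i') = m by ring] at h4
      have hmR : (0 : ℝ) < m := by exact_mod_cast hm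
      push_cast at hBk hBk'
      -- The factors `i + 1` and `m - i'` in the column formulas are both at least `B / 2`.
      have hx : B / (Real.pi * (m + 1)) ≤ m * ‖M (2 * i + 1) m‖ ^ 2 := by
        rw [h1]
        calc B / (Real.pi * (m + 1)) = 2 / (Real.pi * (m + 1)) * (B / 2) := by ring
          _ ≤ _ := mul_le_mul h3 (by linarith) (by linarith)
            (mul_pos (centralRatio_pos _) (centralRatio_pos _)).le
      have hy : B / (Real.pi * (m + 1)) ≤ m * ‖M (i' + i') m‖ ^ 2 := by
        rw [← two_mul, h2]
        calc B / (Real.pi * (m + 1)) = 2 / (Real.pi * (m + 1)) * (B / 2) := by ring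
          _ ≤ _ := mul_le_mul h4 (by linarith) (by linarith)
            (mul_pos (centralRatio_pos _) (centralRatio_pos _)).le
      have hxy := le_mul_of_le_sq (d := B / (Real.pi * (m + 1)) / m)
        (norm_nonneg (M (2 * i + 1) m)) (norm_nonneg (M (i' + i') m))
        (by rw [div_le_iff₀ hmR]; linarith) (by rw [div_le_iff₀ hmR]; linarith)
      rw [div_div, div_le_iff₀ (by positivity)] at hxy
      simp only [norm_mul, RCLike.norm_conj, Complex.norm_natCast]
      push_cast
      nlinarith
  · have hm : 0 < m := by omega
    rw [show (2 * m + 1 + 1) / 2 = m + 1 by omega, Nat.add_sub_cancel]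
    -- Column `m` vanishes at odd `k`, which kills the first term; `right_succ` then expresses `M k
    -- (m + 1)` by the entry `M (k - 1) m` of the middle column.
    refine ⟨fun k => ladderCoeff (2 * m + 1) k * M (k - 1) m, fun k' => conj (M k' m), ?_⟩
    intro k k' hk hk' hkn hkn'
    obtain ⟨i, rfl⟩ := hk
    obtain ⟨i', rfl⟩ := hk'
    refine ⟨?_, ?_⟩
    · have h0 := (hM.odd_column i (by omega)).2 (by omega)
      have h1 := hM.right_succ (2 * i + 1) m
      rw [h0] at h1 ⊢
      linear_combination -(1 / 2) * conj (M (i' + i') m) * h1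
    · intro B hB hBk hBk' _
      have h1 := (hM.odd_column i (by omega)).1
      have h2 := (hM.odd_column i' (by omega)).1
      have h3 := le_centralRatio_mul i (m - i)
      have h4 := le_centralRatio_mul i' (m - i')
      rw [Nat.cast_sub (by omega)] at h3 h4
      rw [show (i : ℝ) + ((m : ℝ) - i) = m by ring, ← h1] at h3
      rw [show (i' : ℝ) + ((m : ℝ) - i') = m by ring, ← h2, two_mul i'] at h4
      have hxy := le_mul_of_le_sq (norm_nonneg (M (2 * i) m)) (norm_nonneg (M (i' + i') m)) h3 h4
      rw [div_le_iff₀ (by positivity)] at hxy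
      have hc : B ≤ 2 * ladderCoeff (2 * m + 1) (2 * i + 1) := by
        refine le_of_sq_le_sq ?_ (mul_nonneg two_pos.le
          (ladderCoeff_pos (by omega) (by omega)).le)
        rw [two_mul_ladderCoeff_sq (by omega), sq]
        exact mul_le_mul hBk hBk' hB (Nat.cast_nonneg _)
      have hc0 := (ladderCoeff_pos (n := 2 * m + 1) (k := 2 * i + 1) (by omega) (by omega)).le
      simp only [norm_mul, RCLike.norm_conj, Complex.norm_real, Real.norm_eq_abs,
        Nat.add_sub_cancel, abs_of_nonneg hc0]
      set N := ‖M (2 * i) m‖ * ‖M (i' + i') m‖ with hN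
      have hN0 : 0 ≤ N := by positivity
      calc 2 * B ≤ B * (N * (Real.pi * (m + 1))) := by nlinarith
        _ ≤ 2 * ladderCoeff (2 * m + 1) (2 * i + 1) * (N * (Real.pi * (m + 1))) := by gcongr
        _ = Real.pi * (2 * m + 2) * (ladderCoeff (2 * m + 1) (2 * i + 1) * N) := by ring
        _ ≤ _ := by
          push_cast
          rw [mul_assoc _ _ (‖M (i' + i') m‖), ← hN]
          gcongr
          linarith

end Factorization

/-! ### Spectral projections and the upper bound. -/

section Projection

variable {E : Type*} [NormedAddCommGroup E] [InnerProductSpace ℂ E]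

lemma aeval_apply_of_eigen {A : E →L[ℂ] E} {v : E} {a : ℝ} (hv : A v = (a : ℂ) • v)
    (q : Polynomial ℝ) : (Polynomial.aeval A q) v = ((q.eval a : ℝ) : ℂ) • v := by
  induction q using Polynomial.induction_on with
  | C r => rw [Polynomial.aeval_C, Polynomial.eval_C, Algebra.algebraMap_eq_smul_one]; rfl
  | add p q hp hq => simp [hp, hq, add_smul]
  | monomial m r ih =>
    rw [pow_succ, ← mul_assoc, map_mul, Polynomial.aeval_X, mul_apply_eq_comp, hv, map_smul, ih]
    rw [smul_smul, ← Complex.ofReal_mul]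
    congr 2
    simp only [Polynomial.eval_mul, Polynomial.eval_C, Polynomial.eval_pow, Polynomial.eval_X]
    ring

lemma norm_commutator_le_half {P Q : E →L[ℂ] E} (hP : ‖(2 : ℝ) • P - 1‖ ≤ 1)
    (hQ : ‖(2 : ℝ) • Q - 1‖ ≤ 1) : ‖⁅P, Q⁆‖ ≤ 1 / 2 := by
  set A := (2 : ℝ) • P - 1
  set B := (2 : ℝ) • Q - 1
  have h : ⁅P, Q⁆ = (1 / 4 : ℝ) • (A * B - B * A) := by
    have hA : P = (1 / 2 : ℝ) • (A + 1) := by simp only [A]; module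
    have hB : Q = (1 / 2 : ℝ) • (B + 1) := by simp only [B]; module
    rw [Ring.lie_def]
    conv_lhs => rw [hA, hB]
    simp only [smul_mul_smul_comm, mul_add, add_mul, mul_one, one_mul]
    module
  have h1 : ‖A * B‖ ≤ 1 := (norm_mul_le _ _).trans (mul_le_one₀ hP (norm_nonneg _) hQ)
  have h2 : ‖B * A‖ ≤ 1 := (norm_mul_le _ _).trans (mul_le_one₀ hQ (norm_nonneg _) hP)
  rw [h, norm_smul]
  have h3 := norm_sub_le (A * B) (B * A)
  norm_num
  linarith

variable [CompleteSpace E] [FiniteDimensional ℂ E]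

/-- On a finite spectrum every function is continuous, so the continuous functional calculus applies
to the indicator. -/
lemma finite_spectrum_real (A : E →L[ℂ] E) : (spectrum ℝ A).Finite := by
  have h : (spectrum ℂ A).Finite := by
    rw [ContinuousLinearMap.spectrum_eq]
    exact Module.End.finite_spectrum _
  rw [← spectrum.preimage_algebraMap ℂ]
  exact h.preimage (FaithfulSMul.algebraMap_injective ℝ ℂ).injOn

lemma positiveProjection_apply_of_eigen {A : E →L[ℂ] E} (hA : IsSelfAdjoint A) {v : E} {a : ℝ}
    (hv : A v = (a : ℂ) • v) : positiveProjection A v = if 0 < a then v else 0 := by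
  classical
  -- Adjoining `a` covers `v = 0`, which occurs for the padded basis vectors, where `a` need not be
  -- in the spectrum.
  let s : Finset ℝ := insert a (finite_spectrum_real A).toFinset
  let f : ℝ → ℝ := (Set.Ioi (0 : ℝ)).indicator fun _ => (1 : ℝ)
  let q := Lagrange.interpolate s id f
  have hq : ∀ x ∈ s, q.eval x = f x := fun x hx =>
    Lagrange.eval_interpolate_at_node (v := id) f (Set.injOn_id _) hx
  have h1 : positiveProjection A = Polynomial.aeval A q := by
    rw [← cfc_polynomial q A hA]
    refine cfc_congr fun x hx => (hq x ?_).symm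
    exact Finset.mem_insert_of_mem ((Set.Finite.mem_toFinset _).2 hx)
  rw [h1, aeval_apply_of_eigen hv, hq a (Finset.mem_insert_self _ _)]
  by_cases ha : 0 < a
  · simp [f, ha]
  · simp [f, ha]

lemma norm_two_smul_positiveProjection_sub_one_le {A : E →L[ℂ] E} (hA : IsSelfAdjoint A) :
    ‖(2 : ℝ) • positiveProjection A - 1‖ ≤ 1 := by
  have hc : ∀ f : ℝ → ℝ, ContinuousOn f (spectrum ℝ A) := fun f =>
    (finite_spectrum_real A).continuousOn f
  rw [positiveProjection, ← cfc_const_mul _ _ _ (hc _), ← cfc_const_one ℝ A,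
    ← cfc_sub _ _ _ (hc _) (hc _)]
  refine norm_cfc_le zero_le_one fun x _ => ?_
  by_cases hx : 0 < x
  · norm_num [hx]
  · norm_num [hx]

end Projection

/-! ### Matrix entries of the projection and of the commutator. -/

section Kernel

lemma IsWeightBasis.inner_eq {E : Type*} [NormedAddCommGroup E]
    [InnerProductSpace ℂ E] {n : ℕ} {X Y Z : E →L[ℂ] E} {e : ℕ → E}
    (he : IsWeightBasis n X Y Z e)
    {k l : ℕ} (hk : k < n) (hl : l < n) :
    inner ℂ (e k) (e l) = if k = l then 1 else 0 := by
  have := (orthonormal_iff_ite.1 he.orthonormal) ⟨k, hk⟩ ⟨l, hl⟩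
  simpa using this

variable {E : Type*} [NormedAddCommGroup E] [InnerProductSpace ℂ E] [CompleteSpace E]
  {n : ℕ} {X Y Z : E →L[ℂ] E} {e f : ℕ → E}

/-- The relations say that `X`, `Z` and `Y` can be moved across the inner product; the normalization
is Parseval for `f 0`. -/
lemma isOverlap_inner (hn : 1 ≤ n) (hdim : Module.finrank ℂ E = n)
    (hX : IsSelfAdjoint X) (hY : IsSelfAdjoint Y) (hZ : IsSelfAdjoint Z)
    (he : IsWeightBasis n X Y Z e) (hf : IsWeightBasis n Z (-Y) X f) :
    IsOverlap n (fun k l => inner ℂ (e k) (f l)) where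
  left k l := by
    have h : inner ℂ (X (e k)) (f l) = inner ℂ (e k) (X (f l)) := hX.isSymmetric _ _
    rw [he.apply_X, hf.apply_Z, inner_add_left, inner_smul_left, inner_smul_left,
      inner_smul_right, Complex.conj_ofReal, Complex.conj_ofReal] at h
    exact h.symm
  right k l := by
    have h : inner ℂ (Z (e k)) (f l) = inner ℂ (e k) (Z (f l)) := hZ.isSymmetric _ _
    rw [he.apply_Z, hf.apply_X, inner_add_right, inner_smul_left, inner_smul_right,
      inner_smul_right, Complex.conj_ofReal] at h
    exact h
  mixed k l := by
    have h : inner ℂ (Y (e k)) (f l) = inner ℂ (e k) (Y (f l)) := hY.isSymmetric _ _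
    have hYf : Y (f l) = -((-Y) (f l)) := by simp
    rw [hYf, he.apply_Y, hf.apply_Y, inner_neg_right, inner_smul_left, inner_smul_right,
      inner_sub_left, inner_sub_right, inner_smul_left, inner_smul_left, inner_smul_right,
      inner_smul_right, Complex.conj_ofReal, Complex.conj_ofReal, map_neg, Complex.conj_I] at h
    apply mul_left_cancel₀ Complex.I_ne_zero
    linear_combination h
  sum_norm_sq := by
    have hfin : FiniteDimensional ℂ E := .of_finrank_pos (by omega)
    have hspan : ⊤ ≤ Submodule.span ℂ (Set.range fun k : Fin n => e k) := by
      rw [he.orthonormal.linearIndependent.span_eq_top_of_card_eq_finrank' (by simp [hdim])]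
    let b := OrthonormalBasis.mk he.orthonormal hspan
    have h := b.sum_sq_norm_inner_right (f 0)
    have hf0 : ‖f 0‖ = 1 := hf.orthonormal.1 ⟨0, by omega⟩
    rw [hf0, one_pow] at h
    rw [Finset.sum_range]
    simpa [b] using h

lemma weight_pos_iff {k : ℕ} : 0 < weight n k ↔ (n + 1) / 2 ≤ k := by
  rw [weight, sub_pos, div_lt_iff₀ two_pos, sub_lt_iff_lt_add]
  have : ((n : ℝ) < k * 2 + 1) ↔ n < k * 2 + 1 := by exact_mod_cast Iff.rfl
  rw [this]
  omega

variable [FiniteDimensional ℂ E]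

lemma IsWeightBasis.positiveProjection_apply (hZ : IsSelfAdjoint Z)
    (he : IsWeightBasis n X Y Z e) (k : ℕ) :
    positiveProjection Z (e k) = if (n + 1) / 2 ≤ k then e k else 0 := by
  rw [positiveProjection_apply_of_eigen hZ (he.apply_Z k)]
  simp only [weight_pos_iff]

/-- The commutator of `X` with the positive projection of `Z` has rank two. -/
lemma IsWeightBasis.commutator_positiveProjection (hn : 2 ≤ n) (hdim : Module.finrank ℂ E = n)
    (hZ : IsSelfAdjoint Z) (he : IsWeightBasis n X Y Z e) (x : E) :
    X (positiveProjection Z x) - positiveProjection Z (X x) =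
      (ladderCoeff n ((n + 1) / 2) : ℂ) • (inner ℂ (e ((n + 1) / 2)) x • e ((n + 1) / 2 - 1) -
        inner ℂ (e ((n + 1) / 2 - 1)) x • e ((n + 1) / 2)) := by
  set P := positiveProjection Z with hP
  obtain ⟨a, ha⟩ : ∃ a, (n + 1) / 2 = a + 1 := ⟨(n + 1) / 2 - 1, by omega⟩
  have hPe : ∀ k, P (e k) = if a + 1 ≤ k then e k else 0 := fun k => by
    rw [hP, he.positiveProjection_apply hZ, ha]
  rw [ha, Nat.add_sub_cancel]
  have hspan : ⊤ ≤ Submodule.span ℂ (Set.range fun k : Fin n => e k) := by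
    rw [he.orthonormal.linearIndependent.span_eq_top_of_card_eq_finrank' (by simp [hdim])]
  let S : E →L[ℂ] E := X * P - P * X
  let T : E →L[ℂ] E := (ladderCoeff n (a + 1) : ℂ) •
    ((innerSL ℂ (e (a + 1))).smulRight (e a) - (innerSL ℂ (e a)).smulRight (e (a + 1)))
  have hST : (S : E →ₗ[ℂ] E) = T := by
    refine LinearMap.ext_on_range (v := fun k : Fin n => e k) (top_le_iff.1 hspan) fun k => ?_
    obtain ⟨k, hk⟩ := k
    change X (P (e k)) - P (X (e k)) = (ladderCoeff n (a + 1) : ℂ) •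
      (inner ℂ (e (a + 1)) (e k) • e a - inner ℂ (e a) (e k) • e (a + 1))
    rw [he.inner_eq (by omega) hk, he.inner_eq (by omega) hk, hPe, he.apply_X, map_add, map_smul,
      map_smul, hPe, hPe]
    -- `X` moves indices by one, so only `e a` and `e (a + 1)` have neighbours across the cut.
    rcases lt_trichotomy k a with h | rfl | h
    · rw [if_neg (by omega), if_neg (by omega), if_neg (by omega), if_neg (by omega),
        if_neg (by omega)]
      simp
    · rw [if_neg (by omega), if_pos (by omega), if_neg (by omega), if_neg (by omega), if_pos rfl]
      simp
    · rcases Nat.lt_or_ge k (a + 2) with h' | h'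
      · obtain rfl : k = a + 1 := by omega
        rw [if_pos le_rfl, if_pos (by omega), if_neg (by omega), if_pos rfl, if_neg (by omega),
          he.apply_X]
        simp
      · rw [if_pos (by omega), if_pos (by omega), if_pos (by omega), if_neg (by omega),
          if_neg (by omega), he.apply_X]
        simp
  exact LinearMap.congr_fun hST x

/-- `hf` exchanges the roles of `X` and `Z`: the rank-two commutator is that of `Z` with the
projection of `X`, and taking its entries in the eigenbasis of `Z` produces the factor `k - k'`. -/
lemma inner_positiveProjection (hn : 2 ≤ n) (hdim : Module.finrank ℂ E = n)
    (hX : IsSelfAdjoint X) (hZ : IsSelfAdjoint Z)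
    (he : IsWeightBasis n X Y Z e) (hf : IsWeightBasis n Z (-Y) X f) (k k' : ℕ) :
    ((k : ℂ) - k') * inner ℂ (e k) (positiveProjection X (e k')) =
      (ladderCoeff n ((n + 1) / 2) : ℂ) *
        (inner ℂ (e k) (f ((n + 1) / 2 - 1)) * conj (inner ℂ (e k') (f ((n + 1) / 2))) -
          inner ℂ (e k) (f ((n + 1) / 2)) * conj (inner ℂ (e k') (f ((n + 1) / 2 - 1)))) := by
  have h := congrArg (fun x => inner ℂ (e k) x)
    (hf.commutator_positiveProjection hn hdim hX (e k'))
  simp only [inner_sub_right, inner_smul_right] at h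
  have h1 : inner ℂ (e k) (Z (positiveProjection X (e k'))) =
      weight n k * inner ℂ (e k) (positiveProjection X (e k')) := by
    have : inner ℂ (Z (e k)) (positiveProjection X (e k')) =
      inner ℂ (e k) (Z (positiveProjection X (e k'))) := hZ.isSymmetric _ _
    rw [← this, he.apply_Z, inner_smul_left, Complex.conj_ofReal]
  rw [h1, he.apply_Z, map_smul, inner_smul_right] at h
  rw [inner_conj_symm, inner_conj_symm]
  have hw : (weight n k : ℂ) - weight n k' = k - k' := by
    exact_mod_cast congrArg (fun x : ℝ => (x : ℂ)) (weight_sub n k k')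
  rw [← hw]
  linear_combination h

/-- Matrix entries of the commutator between positive and nonpositive weights. -/
lemma inner_commutator (hZ : IsSelfAdjoint Z) (he : IsWeightBasis n X Y Z e) {k k' : ℕ}
    (hk : n ≤ 2 * k) (hk' : 2 * k' < n) :
    inner ℂ (e k) (⁅positiveProjection X, positiveProjection Z⁆ (e k')) =
      - inner ℂ (e k) (positiveProjection X (e k')) := by
  have h1 : positiveProjection Z (e k') = 0 := by
    rw [he.positiveProjection_apply hZ, if_neg (by omega)]
  have h2 : positiveProjection Z (e k) = e k := by
    rw [he.positiveProjection_apply hZ, if_pos (by omega)]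
  have hsa : IsSelfAdjoint (positiveProjection Z) := cfc_predicate _ _
  have h3 : inner ℂ (positiveProjection Z (e k)) (positiveProjection X (e k')) =
    inner ℂ (e k) (positiveProjection Z (positiveProjection X (e k'))) := hsa.isSymmetric _ _
  rw [Ring.lie_def, sub_apply, mul_apply_eq_comp, mul_apply_eq_comp, h1, map_zero, zero_sub,
    inner_neg_right, ← h3, h2]

end Kernel

/-! ### A lower bound for a Hilbert-type matrix. -/

section HilbertMatrix

lemma hasDerivAt_arctan_sqrt_div {b x : ℝ} (hb : 0 < b) (hx : 0 < x) :
    HasDerivAt (fun x => 2 / b * Real.arctan (√x / b)) (1 / (√x * (x + b ^ 2))) x := by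
  have h := (((Real.hasDerivAt_sqrt hx.ne').div_const b).arctan).const_mul (2 / b)
  refine h.congr_deriv ?_
  have hs : 0 < √x := Real.sqrt_pos.2 hx
  have hs2 : √x ^ 2 = x := Real.sq_sqrt hx.le
  rw [div_pow, hs2]
  field_simp
  ring

lemma arctan_sqrt_sub_le {b x : ℝ} (hb : 0 < b) (hx : 0 < x) :
    2 / b * Real.arctan (√(x + 1) / b) - 2 / b * Real.arctan (√x / b) ≤
      1 / (√x * (x + b ^ 2)) := by
  have hd : ∀ y ∈ Set.Icc x (x + 1),
      HasDerivAt (fun x => 2 / b * Real.arctan (√x / b)) (1 / (√y * (y + b ^ 2))) y :=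
    fun y hy => hasDerivAt_arctan_sqrt_div hb (hx.trans_le hy.1)
  have h := (convex_Icc x (x + 1)).image_sub_le_mul_sub_of_deriv_le
    (f := fun x => 2 / b * Real.arctan (√x / b)) (C := 1 / (√x * (x + b ^ 2)))
    (fun y hy => (hd y hy).continuousAt.continuousWithinAt)
    (fun y hy => (hd y (interior_subset hy)).differentiableAt.differentiableWithinAt)
    (fun y hy => by
      have hy' := interior_subset hy
      have hsx : 0 < √x := Real.sqrt_pos.2 hx
      rw [(hd y hy').deriv]
      have h1 : x ≤ y := hy'.1
      gcongr)
    x (Set.left_mem_Icc.2 (by linarith)) (x + 1) (Set.right_mem_Icc.2 (by linarith)) (by linarith)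
  simpa using h

lemma arctan_le_self {x : ℝ} (hx : 0 ≤ x) : Real.arctan x ≤ x := by
  rcases hx.eq_or_lt with rfl | h
  · simp
  · simpa using Real.le_tan (Real.arctan_pos.2 h).le (Real.arctan_lt_pi_div_two x)

/-- The sum is compared with the integral of `1 / (√x (x + b²))`, which is `π / b` over the
half-line; the subtracted terms bound its tail beyond `L + 1` and its part below `1`. -/
lemma le_sum_hilbert_row {b : ℝ} (hb : 0 < b) (L : ℕ) :
    Real.pi / b - 2 / √(L + 1) - 2 / b ^ 2 ≤
      ∑ s ∈ Finset.range L, 1 / (√((s : ℝ) + 1) * (s + 1 + b ^ 2)) := by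
  have htel : ∑ s ∈ Finset.range L, (2 / b * Real.arctan (√(((s + 1 : ℕ) : ℝ) + 1) / b) -
      2 / b * Real.arctan (√((s : ℝ) + 1) / b)) ≤
      ∑ s ∈ Finset.range L, 1 / (√((s : ℝ) + 1) * (s + 1 + b ^ 2)) := by
    refine Finset.sum_le_sum fun s _ => ?_
    push_cast
    exact arctan_sqrt_sub_le hb (by positivity)
  rw [Finset.sum_range_sub (fun s : ℕ => 2 / b * Real.arctan (√((s : ℝ) + 1) / b))] at htel
  refine le_trans ?_ htel
  have hsL : 0 < √((L : ℝ) + 1) := Real.sqrt_pos.2 (by positivity)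
  have h1 : Real.pi / 2 - b / √(L + 1) ≤ Real.arctan (√(L + 1) / b) := by
    have := Real.arctan_inv_of_pos (x := √((L : ℝ) + 1) / b) (by positivity)
    rw [inv_div] at this
    have h2 := arctan_le_self (x := b / √((L : ℝ) + 1)) (by positivity)
    linarith
  have h2 : Real.arctan (1 / b) ≤ 1 / b := arctan_le_self (by positivity)
  have h3 : 2 / b * (Real.pi / 2 - b / √(L + 1) - 1 / b) ≤
      2 / b * (Real.arctan (√(L + 1) / b) - Real.arctan (1 / b)) := by gcongr
  have h4 : 2 / b * (Real.pi / 2 - b / √(L + 1) - 1 / b) =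
      Real.pi / b - 2 / √(L + 1) - 2 / b ^ 2 := by field_simp
  rw [← h4]
  refine h3.trans (le_of_eq ?_)
  simp only [Nat.cast_zero, zero_add, Real.sqrt_one]
  ring

lemma sum_one_div_sqrt_le (L : ℕ) :
    ∑ t ∈ Finset.range L, 1 / √((t : ℝ) + 1) ≤ 2 * √L := by
  induction L with
  | zero => simp
  | succ L ih =>
    rw [Finset.sum_range_succ]
    have h1 : 0 < √((L : ℝ) + 1) := Real.sqrt_pos.2 (by positivity)
    have h2 : √((L : ℝ) + 1) ^ 2 = L + 1 := Real.sq_sqrt (by positivity)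
    have h3 : √(L : ℝ) ^ 2 = L := Real.sq_sqrt (by positivity)
    have h4 : 1 / √((L : ℝ) + 1) ≤ 2 * (√((L : ℝ) + 1) - √L) := by
      rw [div_le_iff₀ h1]
      nlinarith [sq_nonneg (√((L : ℝ) + 1) - √L)]
    push_cast
    linarith

lemma exists_sum_le : ∃ K : ℝ, ∀ L : ℕ,
    ∑ t ∈ Finset.range L, 1 / (((t : ℝ) + 1) * √((t : ℝ) + 1)) ≤ K := by
  have h : Summable fun t : ℕ => 1 / (((t : ℝ) + 1) * √((t : ℝ) + 1)) := by
    have h1 := (summable_nat_add_iff 1).2 (Real.summable_one_div_nat_rpow.2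
      (show (1 : ℝ) < 3 / 2 by norm_num))
    refine h1.congr fun t => ?_
    have h2 : (0 : ℝ) < (t : ℝ) + 1 := by positivity
    push_cast
    rw [show (3 / 2 : ℝ) = 1 + 1 / 2 by norm_num, Real.rpow_add h2, Real.rpow_one,
      ← Real.sqrt_eq_rpow]
  exact ⟨_, fun L => h.sum_le_tsum _ fun t _ => by positivity⟩

/-- The sections of the Hilbert-type matrix `1 / (2 (s + t) + 5)` have norms approaching `π / 2`,
as witnessed by the vector with entries `1 / √(s + 1)`. -/
lemma exists_hilbert_lower_bound {δ : ℝ} (hδ : 0 < δ) : ∃ L : ℕ, 0 < L ∧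
    (Real.pi / 2 - δ) * ∑ s ∈ Finset.range L, 1 / ((s : ℝ) + 1) ≤
      ∑ s ∈ Finset.range L, ∑ t ∈ Finset.range L,
        1 / √((s : ℝ) + 1) * (1 / √((t : ℝ) + 1)) * (1 / (2 * (s + t) + 5)) := by
  obtain ⟨K, hK⟩ := exists_sum_le
  -- The total error is at most `2 K + 2` for every `L`, and the divergent harmonic sum absorbs it.
  obtain ⟨L, hL0, hL⟩ : ∃ L : ℕ, 0 < L ∧
      (2 * K + 2) / δ ≤ ∑ s ∈ Finset.range L, 1 / ((s : ℝ) + 1) :=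
    ((Filter.eventually_gt_atTop 0).and
      (Real.tendsto_sum_range_one_div_nat_succ_atTop.eventually_ge_atTop _)).exists
  refine ⟨L, hL0, ?_⟩
  have hpi4 := Real.pi_le_four
  have hpi := Real.pi_pos
  have hrow : ∀ t : ℕ, Real.pi * (1 / ((t : ℝ) + 1)) - 4 * (1 / (((t : ℝ) + 1) * √((t : ℝ) + 1)))
      - 2 / √((L : ℝ) + 1) * (1 / √((t : ℝ) + 1)) ≤
      1 / √((t : ℝ) + 1) *
        ∑ s ∈ Finset.range L, 1 / (√((s : ℝ) + 1) * (s + 1 + (t + 3 / 2))) := by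
    intro t
    set r := √((t : ℝ) + 1) with hr
    have hr1 : 1 ≤ r := Real.one_le_sqrt.2 (by linarith [(Nat.cast_nonneg t : (0 : ℝ) ≤ t)])
    have hr2 : r ^ 2 = t + 1 := Real.sq_sqrt (by positivity)
    -- From `2 (s + t) + 5 = 2 ((s + 1) + (t + 3 / 2))`.
    set b := √((t : ℝ) + 3 / 2) with hb
    have hb0 : 0 < b := Real.sqrt_pos.2 (by positivity)
    have hb2 : b ^ 2 = t + 3 / 2 := Real.sq_sqrt (by positivity)
    have hrb : r ≤ b := Real.sqrt_le_sqrt (by linarith)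
    have h := le_sum_hilbert_row hb0 L
    rw [hb2] at h
    refine le_trans ?_ (mul_le_mul_of_nonneg_left h (by positivity : 0 ≤ 1 / r))
    rw [← hb2, ← hr2]
    have e1 : 1 / r ^ 2 - 1 / (2 * r ^ 4) ≤ 1 / (r * b) := by
      have : 1 / b ^ 2 ≤ 1 / (r * b) := by
        rw [sq]; gcongr
      refine le_trans ?_ this
      have hb3 : b ^ 2 = r ^ 2 + 1 / 2 := by rw [hb2, hr2]; ring
      rw [hb3, ← sub_nonneg]
      have : 1 / (r ^ 2 + 1 / 2) - (1 / r ^ 2 - 1 / (2 * r ^ 4)) =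
          1 / (4 * r ^ 4 * (r ^ 2 + 1 / 2)) := by field_simp; ring
      rw [this]; positivity
    have e2 : 1 / (2 * r ^ 4) ≤ 1 / (2 * r ^ 3) := by
      have : r ^ 3 ≤ r ^ 4 := pow_le_pow_right₀ hr1 (by norm_num)
      gcongr
    have e3 : 1 / (r * b ^ 2) ≤ 1 / r ^ 3 := by
      rw [show r ^ 3 = r * r ^ 2 by ring]; gcongr
    have e4 : 1 / r ^ 2 - 1 / (2 * r ^ 3) ≤ 1 / (r * b) := by linarith
    have e5 := mul_le_mul_of_nonneg_left e4 hpi.le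
    have e6 : Real.pi * (1 / (2 * r ^ 3)) ≤ 2 * (1 / r ^ 3) := by
      calc Real.pi * (1 / (2 * r ^ 3)) ≤ 4 * (1 / (2 * r ^ 3)) := by gcongr
        _ = 2 * (1 / r ^ 3) := by field_simp; norm_num
    have e7 : 1 / r * (Real.pi / b - 2 / √((L : ℝ) + 1) - 2 / b ^ 2) =
        Real.pi * (1 / (r * b)) - 2 / √((L : ℝ) + 1) * (1 / r) - 2 * (1 / (r * b ^ 2)) := by
      field_simp
    rw [e7, show r ^ 2 * r = r ^ 3 by ring]
    linarith
  have hdouble : ∑ s ∈ Finset.range L, ∑ t ∈ Finset.range L,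
        1 / √((s : ℝ) + 1) * (1 / √((t : ℝ) + 1)) * (1 / (2 * (s + t) + 5)) =
      1 / 2 * ∑ t ∈ Finset.range L, 1 / √((t : ℝ) + 1) *
        ∑ s ∈ Finset.range L, 1 / (√((s : ℝ) + 1) * (s + 1 + (t + 3 / 2))) := by
    rw [Finset.sum_comm, Finset.mul_sum]
    refine Finset.sum_congr rfl fun t _ => ?_
    rw [Finset.mul_sum, Finset.mul_sum]
    refine Finset.sum_congr rfl fun s _ => ?_
    have h1 : 0 < √((s : ℝ) + 1) := Real.sqrt_pos.2 (by positivity)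
    have h2 : 0 < √((t : ℝ) + 1) := Real.sqrt_pos.2 (by positivity)
    rw [show (2 * ((s : ℝ) + t) + 5) = 2 * (s + 1 + (t + 3 / 2)) by ring]
    field_simp
  rw [hdouble]
  have hsum := Finset.sum_le_sum (s := Finset.range L) fun t _ => hrow t
  rw [Finset.sum_sub_distrib, Finset.sum_sub_distrib, ← Finset.mul_sum, ← Finset.mul_sum,
    ← Finset.mul_sum] at hsum
  have h1 := hK L
  have h2 : 2 / √((L : ℝ) + 1) * ∑ t ∈ Finset.range L, 1 / √((t : ℝ) + 1) ≤ 4 := by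
    have hs : 0 < √((L : ℝ) + 1) := Real.sqrt_pos.2 (by positivity)
    have hle : √(L : ℝ) ≤ √((L : ℝ) + 1) := Real.sqrt_le_sqrt (by linarith)
    calc _ ≤ 2 / √((L : ℝ) + 1) * (2 * √((L : ℝ) + 1)) := by
          gcongr
          exact (sum_one_div_sqrt_le L).trans (by gcongr)
      _ = 4 := by field_simp; norm_num
  rw [div_le_iff₀ hδ] at hL
  linarith

end HilbertMatrix

/-! ### Test vectors that absorb phases. -/

section LowerBound

variable {E : Type*} [NormedAddCommGroup E] [InnerProductSpace ℂ E]

/-- Testing an operator whose matrix entries are `κ s t * g s * h t` on vectors with moduli `α`. -/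
lemma sum_le_norm_mul_of_entries {ι : Type*} [Fintype ι] {T : E →L[ℂ] E} {v w : ι → E}
    (hv : Orthonormal ℂ v) (hw : Orthonormal ℂ w) {g h : ι → ℂ} {κ : ι → ι → ℝ} (α : ι → ℝ)
    (hT : ∀ s t, inner ℂ (v s) (T (w t)) = κ s t * (g s * h t)) :
    ∑ s, ∑ t, α s * α t * (κ s t * (‖g s‖ * ‖h t‖)) ≤ ‖T‖ * ∑ s, α s ^ 2 := by
  let a : ι → ℂ := fun s => α s * (g s / ‖g s‖)
  let c : ι → ℂ := fun t => α t * (starRingEnd ℂ (h t) / ‖h t‖)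
  have hphase : ∀ z : ℂ, starRingEnd ℂ (z / ‖z‖) * z = ‖z‖ := by
    intro z
    by_cases hz : z = 0
    · simp [hz]
    · have : (‖z‖ : ℂ) ≠ 0 := by simpa using hz
      rw [map_div₀, Complex.conj_ofReal, div_mul_eq_mul_div, mul_comm, Complex.mul_conj,
        Complex.normSq_eq_norm_sq, div_eq_iff this]
      push_cast; ring
  have hphase' : ∀ z : ℂ, starRingEnd ℂ z / ‖z‖ * z = ‖z‖ := by
    intro z
    have := hphase z
    rwa [map_div₀, Complex.conj_ofReal] at this
  -- Only an inequality, since `z / ‖z‖` is `0` at `z = 0`.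
  have hle : ∀ z : ℂ, ‖z / ‖z‖‖ ≤ 1 := by
    intro z
    rw [norm_div, Complex.norm_real, norm_norm]
    exact div_self_le_one _
  have hnorm : ∀ (u : ι → E) (d : ι → ℂ), Orthonormal ℂ u → (∀ s, ‖d s‖ ^ 2 ≤ α s ^ 2) →
      ‖∑ s, d s • u s‖ ^ 2 ≤ ∑ s, α s ^ 2 := by
    intro u d hu hd
    have h1 := hu.inner_sum d d Finset.univ
    have h2 : (inner ℂ (∑ s, d s • u s) (∑ s, d s • u s)).re = ‖∑ s, d s • u s‖ ^ 2 :=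
      inner_self_eq_norm_sq (𝕜 := ℂ) _
    rw [← h2, h1, Complex.re_sum]
    refine Finset.sum_le_sum fun s _ => ?_
    rw [mul_comm, Complex.mul_conj, Complex.ofReal_re, Complex.normSq_eq_norm_sq]
    exact hd s
  have ha : ‖∑ s, a s • v s‖ ^ 2 ≤ ∑ s, α s ^ 2 := hnorm v a hv fun s => by
    simp only [a, norm_mul, mul_pow, Complex.norm_real, Real.norm_eq_abs, sq_abs]
    exact mul_le_of_le_one_right (sq_nonneg _) (pow_le_one₀ (norm_nonneg _) (hle _))
  have hc : ‖∑ s, c s • w s‖ ^ 2 ≤ ∑ s, α s ^ 2 := hnorm w c hw fun s => by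
    simp only [c, norm_mul, mul_pow, Complex.norm_real, Real.norm_eq_abs, sq_abs]
    refine mul_le_of_le_one_right (sq_nonneg _) (pow_le_one₀ (norm_nonneg _) ?_)
    simpa using hle (starRingEnd ℂ (h s))
  have hinner : inner ℂ (∑ s, a s • v s) (T (∑ s, c s • w s)) =
      ((∑ s, ∑ t, α s * α t * (κ s t * (‖g s‖ * ‖h t‖)) : ℝ) : ℂ) := by
    rw [map_sum, sum_inner]
    push_cast
    refine Finset.sum_congr rfl fun s _ => ?_
    rw [inner_sum]
    refine Finset.sum_congr rfl fun t _ => ?_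
    rw [map_smul, inner_smul_left, inner_smul_right, hT]
    simp only [a, c, map_mul, Complex.conj_ofReal]
    linear_combination (α s * α t * κ s t : ℂ) *
      (starRingEnd ℂ (h t) / ‖h t‖ * h t * hphase (g s) + ‖g s‖ * hphase' (h t))
  have h1 := norm_inner_le_norm (𝕜 := ℂ) (∑ s, a s • v s) (T (∑ s, c s • w s))
  rw [hinner, Complex.norm_real, Real.norm_eq_abs] at h1
  have h2 := T.le_opNorm (∑ s, c s • w s)
  have h3 : ‖∑ s, a s • v s‖ * ‖∑ s, c s • w s‖ ≤ ∑ s, α s ^ 2 := by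
    nlinarith [sq_nonneg (‖∑ s, a s • v s‖ - ‖∑ s, c s • w s‖)]
  calc _ ≤ _ := le_abs_self _
    _ ≤ _ := h1
    _ ≤ ‖∑ s, a s • v s‖ * (‖T‖ * ‖∑ s, c s • w s‖) := by gcongr
    _ = ‖T‖ * (‖∑ s, a s • v s‖ * ‖∑ s, c s • w s‖) := by ring
    _ ≤ _ := by gcongr

end LowerBound

/-! ### Assembly for a fixed dimension. -/

section Main

variable {E : Type*} [NormedAddCommGroup E] [InnerProductSpace ℂ E] [CompleteSpace E]
  {ρ : SU2 →* unitary (E →L[ℂ] E)}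

lemma norm_C_le_half [FiniteDimensional ℂ E] (hdiff : IsDifferentiable ρ) : ‖C ρ‖ ≤ 1 / 2 :=
  norm_commutator_le_half
    (norm_two_smul_positiveProjection_sub_one_le (isSelfAdjoint_J hdiff 0))
    (norm_two_smul_positiveProjection_sub_one_le (isSelfAdjoint_J hdiff 2))

lemma exists_weightBases [FiniteDimensional ℂ E] {n : ℕ} (hn : 1 ≤ n)
    (hdim : Module.finrank ℂ E = n) (hdiff : IsDifferentiable ρ)
    (hirr : (toRepresentation ρ).IsIrreducible) :
    ∃ e f, IsWeightBasis n (J ρ 0) (J ρ 1) (J ρ 2) e ∧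
      IsWeightBasis n (J ρ 2) (-J ρ 1) (J ρ 0) f := by
  have hXY := J_commutator_zero_one hdiff
  have hYZ := J_commutator_one_two hdiff
  have hZX := J_commutator_two_zero hdiff
  have hX := isSelfAdjoint_J hdiff 0
  have hY := isSelfAdjoint_J hdiff 1
  have hZ := isSelfAdjoint_J hdiff 2
  have hinv : ∀ W : Submodule ℂ E, (∀ w ∈ W, J ρ 0 w ∈ W ∧ J ρ 1 w ∈ W ∧ J ρ 2 w ∈ W) →
      W = ⊥ ∨ W = ⊤ := by
    intro W hW
    refine eq_bot_or_eq_top_of_J_invariant hdiff hirr W fun k w hw => ?_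
    obtain ⟨h0, h1, h2⟩ := hW w hw
    fin_cases k
    exacts [h0, h1, h2]
  obtain ⟨e, he⟩ := exists_isWeightBasis hn hdim hX hY hZ hXY hYZ hZX hinv
  -- The triple `(J_z, -J_y, J_x)` satisfies the same commutation relations; the sign compensates
  -- for the exchange.
  obtain ⟨f, hf⟩ := exists_isWeightBasis hn hdim hZ hY.neg hX
    (by rw [← hYZ]; noncomm_ring) (by rw [← hXY]; noncomm_ring)
    (by rw [smul_neg, ← hZX]; noncomm_ring)
    (fun W hW => hinv W fun w hw => by
      obtain ⟨h2, h1, h0⟩ := hW w hw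
      exact ⟨h0, by simpa using W.neg_mem h1, h2⟩)
  exact ⟨e, f, he, hf⟩

/-- A block of size `L` next to the middle is tested on `1 / √(s + 1)`; for fixed `L` the prefactor
tends to `1 / π`. -/
lemma le_norm_C [FiniteDimensional ℂ E] {n L : ℕ} (hn : 4 * L + 8 ≤ n)
    (hdim : Module.finrank ℂ E = n) (hdiff : IsDifferentiable ρ)
    (hirr : (toRepresentation ρ).IsIrreducible) :
    ((n : ℝ) - (4 * L + 8)) / (Real.pi * (n + 2)) *
      ∑ s ∈ Finset.range L, ∑ t ∈ Finset.range L,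
        1 / √((s : ℝ) + 1) * (1 / √((t : ℝ) + 1)) * (1 / (2 * (s + t) + 5)) ≤
      ‖C ρ‖ * ∑ s ∈ Finset.range L, 1 / ((s : ℝ) + 1) := by
  have hpi := Real.pi_pos
  have hX := isSelfAdjoint_J hdiff 0
  have hY := isSelfAdjoint_J hdiff 1
  have hZ := isSelfAdjoint_J hdiff 2
  obtain ⟨e, f, he, hf⟩ := exists_weightBases (by omega) hdim hdiff hirr
  have hM := isOverlap_inner (by omega) hdim hX hY hZ he hf
  obtain ⟨g, h, hgh⟩ := hM.exists_factorization (by omega)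
  set q := n / 4 with hq
  -- The odd `k s` lie above `n / 2` and the even `k' t` below it, whatever `n` is modulo `4`. As `q
  -- ≥ L + 2`, the natural subtraction in `k'` does not truncate.
  let k : Fin L → ℕ := fun s => 2 * (q + 1 + s) + 1
  let k' : Fin L → ℕ := fun t => 2 * (q - 1 - t)
  have hk : ∀ s, k s < n := fun s => by have := s.2; simp only [k]; omega
  have hk' : ∀ s, k' s < n := fun s => by have := s.2; simp only [k']; omega
  have hv : Orthonormal ℂ fun s => e (k s) :=
    he.orthonormal.comp (fun s => (⟨k s, hk s⟩ : Fin n)) fun s t hst => by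
      have := congrArg Fin.val hst
      simp only [k] at this
      exact Fin.ext (by omega)
  have hw : Orthonormal ℂ fun s => e (k' s) :=
    he.orthonormal.comp (fun s => (⟨k' s, hk' s⟩ : Fin n)) fun s t hst => by
      have := congrArg Fin.val hst
      have h1 := s.2
      have h2 := t.2
      simp only [k'] at this
      exact Fin.ext (by omega)
  have hfac := fun s t => hgh (k s) (k' t) ⟨q + 1 + s, rfl⟩ ⟨q - 1 - t, two_mul _⟩ (hk s) (hk' t)
  have hdiffk : ∀ s t, (k s : ℝ) - k' t = 2 * (s + t) + 5 := by
    intro s t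
    have h1 : k s = k' t + (2 * (s + t) + 5) := by
      have h1 := s.2
      have h2 := t.2
      simp only [k, k']; omega
    rw [h1]; push_cast; ring
  have hT : ∀ s t, inner ℂ (e (k s)) (C ρ (e (k' t))) =
      ((-(1 / (2 * ((s : ℝ) + t) + 5)) : ℝ) : ℂ) * (g (k s) * h (k' t)) := by
    intro s t
    have h1 := s.2
    have h2 := t.2
    have hp := inner_positiveProjection (by omega) hdim hX hZ he hf (k s) (k' t)
    rw [(hfac s t).1] at hp
    have hc : ((k s : ℂ) - k' t) = ((2 * ((s : ℝ) + t) + 5 : ℝ) : ℂ) := by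
      rw [← hdiffk]; push_cast; ring
    have hne : ((2 * ((s : ℝ) + t) + 5 : ℝ) : ℂ) ≠ 0 :=
      Complex.ofReal_ne_zero.2 (by positivity)
    rw [C, inner_commutator hZ he (by simp only [k]; omega) (by simp only [k']; omega), ← hp, hc]
    push_cast at hne ⊢
    field_simp
  have hT' : ∀ s t, inner ℂ (e (k s)) (C ρ (e (k' t))) =
      ((1 / (2 * ((s : ℝ) + t) + 5) : ℝ) : ℂ) * (-g (k s) * h (k' t)) := by
    intro s t
    rw [hT]; push_cast; ring
  have key := sum_le_norm_mul_of_entries hv hw (g := fun s => -g (k s)) (h := fun t => h (k' t))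
    (fun s : Fin L => 1 / √((s : ℝ) + 1)) hT'
  rw [Finset.sum_range (fun s => 1 / ((s : ℝ) + 1)), Finset.sum_range]
  have hsq : ∀ s : Fin L, (1 / √((s : ℝ) + 1)) ^ 2 = 1 / ((s : ℝ) + 1) := fun s => by
    rw [div_pow, Real.sq_sqrt (by positivity), one_pow]
  simp only [hsq] at key
  refine le_trans ?_ key
  rw [Finset.mul_sum]
  refine Finset.sum_le_sum fun s _ => ?_
  rw [Finset.sum_range, Finset.mul_sum]
  refine Finset.sum_le_sum fun t _ => ?_
  -- This value of `B` is below `k s`, `n - k s` and `n - k' t` for every entry of the block.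
  have hB := (hfac s t).2 (((n : ℝ) - (4 * L + 8)) / 2)
  have hs : ((s : ℕ) : ℝ) + 1 ≤ L := by exact_mod_cast s.2
  have hnR : (4 * (L : ℝ) + 8) ≤ n := by exact_mod_cast hn
  have hq1 : 4 * (q : ℝ) ≤ n := by exact_mod_cast (by omega : 4 * q ≤ n)
  have hq2 : (n : ℝ) ≤ 4 * q + 3 := by exact_mod_cast (by omega : n ≤ 4 * q + 3)
  have hks : (k s : ℝ) = 2 * (q + 1 + s) + 1 := by simp [k]
  have hkt : (k' t : ℝ) = k s - (2 * (s + t) + 5) := by linarith [hdiffk s t]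
  have hs0 : (0 : ℝ) ≤ (s : ℕ) := Nat.cast_nonneg _
  have ht0 : (0 : ℝ) ≤ (t : ℕ) := Nat.cast_nonneg _
  have hB' := hB (by linarith) (by linarith) (by linarith) (by linarith)
  have hd : ((n : ℝ) - (4 * L + 8)) / (Real.pi * (n + 2)) ≤ ‖g (k s)‖ * ‖h (k' t)‖ := by
    rw [div_le_iff₀ (by positivity)]
    linarith
  rw [norm_neg]
  calc _ = 1 / √((s : ℝ) + 1) * (1 / √((t : ℝ) + 1)) * (1 / (2 * (s + t) + 5) *
        (((n : ℝ) - (4 * L + 8)) / (Real.pi * (n + 2)))) := by ring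
    _ ≤ _ := by gcongr

end Main

end SpinCommutator

theorem theorem2 (E : ℕ → Type*) [∀ n, NormedAddCommGroup (E n)]
    [∀ n, InnerProductSpace ℂ (E n)] [∀ n, CompleteSpace (E n)]
    (ρ : ∀ n, SpinCommutator.SU2 →* unitary (E n →L[ℂ] E n))
    (hdim : ∀ n, 1 ≤ n → Module.finrank ℂ (E n) = n)
    (hdiff : ∀ n, 1 ≤ n → SpinCommutator.IsDifferentiable (ρ n))
    (hirr : ∀ n, 1 ≤ n → (SpinCommutator.toRepresentation (ρ n)).IsIrreducible) :
    Filter.Tendsto (fun n => ‖SpinCommutator.C (ρ n)‖) Filter.atTop (nhds (1 / 2)) := by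
  have hpi := Real.pi_pos
  have hfin : ∀ n, 1 ≤ n → FiniteDimensional ℂ (E n) := fun n hn =>
    .of_finrank_pos (by rw [hdim n hn]; omega)
  rw [tendsto_order]
  constructor
  · intro a ha
    -- With this `δ`, `(π / 2 - δ) / π` is the midpoint of `a` and `1 / 2`, which leaves room for
    -- the prefactor.
    obtain ⟨L, hL0, hL⟩ := SpinCommutator.exists_hilbert_lower_bound
      (δ := Real.pi * (1 / 2 - a) / 2) (by nlinarith)
    set H := ∑ s ∈ Finset.range L, 1 / ((s : ℝ) + 1) with hH
    have hHpos : 0 < H := Finset.sum_pos (fun s _ => by positivity) ⟨0, Finset.mem_range.2 hL0⟩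
    have hlim : Filter.Tendsto (fun n : ℕ => ((n : ℝ) - (4 * L + 8)) / (n + 2) *
        (1 / 2 - (1 / 2 - a) / 2)) Filter.atTop (nhds (1 * (1 / 2 - (1 / 2 - a) / 2))) := by
      refine Filter.Tendsto.mul_const _ ?_
      have h1 : Filter.Tendsto (fun n : ℕ => 1 - (4 * (L : ℝ) + 10) / ((n : ℝ) + 2)) Filter.atTop
          (nhds (1 - 0)) :=
        tendsto_const_nhds.sub (tendsto_const_nhds.div_atTop
          (Filter.tendsto_atTop_add_const_right _ _ tendsto_natCast_atTop_atTop))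
      rw [sub_zero] at h1
      refine h1.congr fun n => ?_
      have : (n : ℝ) + 2 ≠ 0 := by positivity
      field_simp
      ring
    have hev := hlim.eventually_const_lt (show a < 1 * (1 / 2 - (1 / 2 - a) / 2) by linarith)
    filter_upwards [hev, Filter.eventually_ge_atTop (4 * L + 8)] with n h1 hn
    have := hfin n (by omega)
    have h2 := SpinCommutator.le_norm_C hn (hdim n (by omega)) (hdiff n (by omega))
      (hirr n (by omega))
    rw [← hH] at h2
    refine h1.trans_le ?_
    have hnR : (4 * (L : ℝ) + 8) ≤ n := by exact_mod_cast hn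
    have hcoef : 0 ≤ ((n : ℝ) - (4 * L + 8)) / (Real.pi * (n + 2)) :=
      div_nonneg (by linarith) (by positivity)
    have h3 := (mul_le_mul_of_nonneg_left hL hcoef).trans h2
    refine le_of_mul_le_mul_right (le_trans (le_of_eq ?_) h3) hHpos
    field_simp
  · intro a ha
    filter_upwards [Filter.eventually_ge_atTop 1] with n hn
    have := hfin n hn
    exact (SpinCommutator.norm_C_le_half (hdiff n hn)).trans_lt ha
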